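/- Let $n_x,n_u\in\mathbb N$, $A,B_1,\dots,B_{n_u}\in\mathbb R^{n_x\times n_x}$, $B_0\in\mathbb R^{n_x\times n_u}$, $\sigma_w>0$ and $\delta\in(0,1)$. Consider the bilinear system $$x^+ = A x + B_0 u + \sum_{i=1}^{n_u}[u]_i\,(B_i-A)\,x + w .$$ Perform $n_u+1$ experiments with constant inputs $u^0=0$ and $u^i=e_i$ (the $i$-th canonical basis vector) for $i=1,\dots,n_u$. In experiment $i$, states $x^{(i)}_1,\dots,x^{(i)}_{T_i}$ are sampled i.i.d. from an arbitrary distribution, independently of the noise $w^{(i)}_1,\dots,w^{(i)}_{T_i}\overset{\text{i.i.d.}}{\sim}\mathcal N(0,\sigma_w^2 I_{n_x})$, and the successor state $x^{(i)+}_t$ of each $x^{(i)}_t$ under the input $u^i$ and the noise $w^{(i)}_t$ is recorded. Put $y^{(i)}_t=\begin{bmatrix}(x^{(i)}_t)^\top & 1\end{bmatrix}^\top$ and let $\hat A$, $\hat B_0$, $\hat B_1,\dots,\hat B_{n_u}$ be any ordinary least squares estimates, that is, $$\hat A\in\arg\min_{A'}\sum_{t=1}^{T_0}\|x^{(0)+}_t-A'x^{(0)}_t\|_2^2,\qquad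 \begin{bmatrix}\hat B_i & [\hat B_0]_i\end{bmatrix}\in\arg\min_{\theta}\sum_{t=1}^{T_i}\|x^{(i)+}_t-\theta\, y^{(i)}_t\|_2^2\quad(i=1,\dots,n_u),$$ where $[\,\cdot\,]_i$ denotes the $i$-th column. Let $$M_0=\sum_{t=1}^{T_0}x^{(0)}_t (x^{(0)}_t)^\top,\qquad M_i=\sum_{t=1}^{T_i}y^{(i)}_t (y^{(i)}_t)^\top\quad(i=1,\dots,n_u).$$ If $T_0\ge n_x$ and $T_i\ge n_x+1$ for all $i=1,\dots,n_u$, then with probability at least $1-\delta$ the following bounds hold simultaneously: $$(\hat A-A)^\top(\hat A-A)\preceq \sigma_w^2\Bigl(2\sqrt{n_x}+\sqrt{2\log(2/\delta)}\Bigr)^2 M_0^{-1},$$ $$\begin{bmatrix}\hat B_i-B_i & [\hat B_0]_i-[B_0]_i\end{bmatrix}^\top\begin{bmatrix}\hat B_i-B_i & [\hat B_0]_i-[B_0]_i\end{bmatrix}\preceq \sigma_w^2\Bigl(\sqrt{n_x+1}+\sqrt{n_x}+\sqrt{2\log(2n_u/\delta)}\Bigr)^2 M_i^{-1}\quad\text{for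 all } i=1,\dots,n_u.$$ If some $M_i$, $i\in\{0,\dots,n_u\}$, has zero as an eigenvalue, the inverse of that eigenvalue is taken to be $+\infty$: $G\preceq cM^{-1}$ means $v^\top G v\le c\sum_k\lambda_k^{-1}(q_k^\top v)^2$ for all $v$, where $(\lambda_k,q_k)$ are orthonormal eigenpairs of $M$, with $0^{-1}=\infty$ and $\infty\cdot 0=0$. -/

import Mathlib

open MeasureTheory ProbabilityTheory Matrix
open scoped ENNReal Matrix

namespace BilinearID

noncomputable section

/-- One step of the bilinear system
`x⁺ = A x + B₀ u + ∑ᵢ [u]ᵢ (Bᵢ - A) x + w`. -/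
def step {nx nu : ℕ} (A : Matrix (Fin nx) (Fin nx) ℝ) (B₀ : Matrix (Fin nx) (Fin nu) ℝ)
    (B : Fin nu → Matrix (Fin nx) (Fin nx) ℝ)
    (x : EuclideanSpace ℝ (Fin nx)) (u : EuclideanSpace ℝ (Fin nu))
    (w : EuclideanSpace ℝ (Fin nx)) : EuclideanSpace ℝ (Fin nx) :=
  WithLp.toLp 2 (A *ᵥ x.ofLp + B₀ *ᵥ u.ofLp + ∑ i, u i • ((B i - A) *ᵥ x.ofLp)) + w

/-- The constant input of experiment `i ∈ {0, …, nu}`: `u⁰ = 0` and `uⁱ = eᵢ` for `i ≥ 1`. -/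
def input {nu : ℕ} (i : Fin (nu + 1)) : EuclideanSpace ℝ (Fin nu) :=
  Fin.cases 0 (fun j => EuclideanSpace.single j 1) i

/-- The affine regressor `y = [xᵀ 1]ᵀ`. -/
def affineRegressor {nx : ℕ} (x : EuclideanSpace ℝ (Fin nx)) : Fin nx ⊕ Unit → ℝ :=
  Sum.elim x.ofLp (fun _ => 1)

/-- The block matrix `[B  b]` with last column `b`. -/
def appendCol {nx : ℕ} (B : Matrix (Fin nx) (Fin nx) ℝ) (b : Fin nx → ℝ) :
    Matrix (Fin nx) (Fin nx ⊕ Unit) ℝ :=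
  Matrix.fromCols B (Matrix.replicateCol Unit b)

/-- `Θ` is an ordinary least squares estimate for the regressors `y` and the targets `z`:
it minimizes `∑ₜ ‖zₜ - Θ yₜ‖₂²` over all matrices. -/
def IsOLS {nx N : ℕ} {ι : Type*} [Fintype ι] (y : Fin N → ι → ℝ)
    (z : Fin N → EuclideanSpace ℝ (Fin nx)) (Θ : Matrix (Fin nx) ι ℝ) : Prop :=
  IsMinOn (fun Θ' : Matrix (Fin nx) ι ℝ => ∑ t, ‖z t - WithLp.toLp 2 (Θ' *ᵥ y t)‖ ^ 2)
    Set.univ Θ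

/-- The data matrix `∑ₜ yₜ yₜᵀ`. -/
def gram {N : ℕ} {ι : Type*} (y : Fin N → ι → ℝ) : Matrix ι ι ℝ :=
  ∑ t, Matrix.vecMulVec (y t) (y t)

theorem gram_posSemidef {N : ℕ} {ι : Type*} [Fintype ι] (y : Fin N → ι → ℝ) :
    (gram y).PosSemidef :=
  Matrix.posSemidef_sum _ fun t _ => by
    simpa using Matrix.posSemidef_vecMulVec_self_star (y t)

/-- The quadratic form `v ↦ vᵀ M⁻¹ v = ∑ₖ λₖ⁻¹ ⟨qₖ, v⟩²` of the inverse of a positive semidefinite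
matrix `M` with eigenpairs `(λₖ, qₖ)`, where the inverse of a zero eigenvalue is `∞`
(in `ℝ≥0∞`, `0⁻¹ = ∞` and `∞ * 0 = 0`). -/
def invQuadForm {ι : Type*} [Fintype ι] [DecidableEq ι] {M : Matrix ι ι ℝ} (hM : M.PosSemidef)
    (v : EuclideanSpace ℝ ι) : ℝ≥0∞ :=
  ∑ k, (ENNReal.ofReal (hM.isHermitian.eigenvalues k))⁻¹ *
    ENNReal.ofReal (inner ℝ (hM.isHermitian.eigenvectorBasis k) v ^ 2)

/-- The ellipsoidal bound `G ⪯ c M⁻¹` in the Loewner order, `M` positive semidefinite and possibly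
singular: `vᵀ G v ≤ c · vᵀ M⁻¹ v` for all `v`. -/
def LeScaledInv {ι : Type*} [Fintype ι] [DecidableEq ι] (G : Matrix ι ι ℝ) (c : ℝ)
    {M : Matrix ι ι ℝ} (hM : M.PosSemidef) : Prop :=
  ∀ v : EuclideanSpace ℝ ι,
    ENNReal.ofReal (v.ofLp ⬝ᵥ G *ᵥ v.ofLp) ≤ ENNReal.ofReal c * invQuadForm hM v

end

end BilinearID

/-!
By the normal equations, the error `D = Θ - Θ'` of a least squares estimate satisfies
`D M u = ∑ t, ⟪y t, u⟫ • w t` for every `u`, where `M` is the data matrix of the regressors `y` and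
`w` is the noise. Since `uᵀ M u = ∑ t, ⟪y t, u⟫ ^ 2`, the bound `Dᵀ D ⪯ c M⁻¹` on the range of `M`
says that the operator `a ↦ ∑ t, a t • w t` has norm at most `√c` on the column space of the
regressors; outside the range of `M` the right-hand side is infinite.

Conditionally on the regressors this operator is Gaussian, and its domain has dimension at most the
number `d` of regressor entries, so its norm exceeds `σ (√nx + √d + s)` with probability at most
`exp (-s² / 2)`. This tail bound, with its sharp constant, comes from comparing the exponential
moments of the Gaussian families `⟪v ⊗ u, W⟫ + g` and `⟪v, g₁⟫ + ⟪u, g₂⟫` over unit vectors `v` and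
`u`: rotating the first into the second increases the expectation of the smooth maximum
`(∑ i, exp (s i / p)) ^ p`, by Stein's identity. A union bound with failure probabilities `δ / 2`
for the input `0` and `δ / (2 nu)` for each input `eᵢ` concludes.
-/

namespace BilinearID

open Real Module Filter Topology
open scoped RealInnerProductSpace

section Density

variable {E : Type*} [NormedAddCommGroup E] [InnerProductSpace ℝ E]

/-- The Lebesgue density `(2π)^(-d/2) exp (-‖x‖²/2)` of the standard Gaussian measure on a Euclidean
space of dimension `d`. -/
noncomputable def stdGaussianDensity (x : E) : ℝ :=
  ((2 * π) ^ (finrank ℝ E / 2 : ℝ))⁻¹ * exp (-(1 / 2) * ‖x‖ ^ 2)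

lemma stdGaussianDensity_pos (x : E) : 0 < stdGaussianDensity x := by
  unfold stdGaussianDensity; positivity

lemma continuous_stdGaussianDensity : Continuous (stdGaussianDensity (E := E)) := by
  unfold stdGaussianDensity; fun_prop

lemma hasLineDerivAt_stdGaussianDensity (x c : E) :
    HasLineDerivAt ℝ stdGaussianDensity (-stdGaussianDensity x * ⟪c, x⟫) x c := by
  have hsq : HasFDerivAt (fun x : E => -(1 / 2) * ‖x‖ ^ 2) (-innerSL ℝ x) x := by
    refine ((hasStrictFDerivAt_norm_sq x).hasFDerivAt.const_mul (-(1 / 2) : ℝ)).congr_fderiv ?_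
    ext y
    simp
  have h := (hsq.exp.const_mul ((2 * π) ^ (finrank ℝ E / 2 : ℝ))⁻¹).hasLineDerivAt c
  convert! h using 1
  simp only [stdGaussianDensity, _root_.smul_apply, _root_.neg_apply, innerSL_apply_apply,
    smul_eq_mul, real_inner_comm x c]
  ring

lemma exp_mul_sq_norm_mul_stdGaussianDensity (s : ℝ) (x : E) :
    stdGaussianDensity x * exp (s / 2 * ‖x‖ ^ 2) =
      ((2 * π) ^ (finrank ℝ E / 2 : ℝ))⁻¹ * exp (-((1 - s) / 2) * ‖x‖ ^ 2) := by
  rw [stdGaussianDensity, mul_assoc, ← Real.exp_add]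
  ring_nf

variable [FiniteDimensional ℝ E] [MeasurableSpace E] [BorelSpace E]

lemma integrable_exp_neg_mul_sq_norm {b : ℝ} (hb : 0 < b) :
    Integrable (fun x : E => exp (-b * ‖x‖ ^ 2)) := by
  have h := (GaussianFourier.integrable_cexp_neg_mul_sq_norm_add (V := E) (b := (b : ℂ))
    (by simpa using hb) 0 0).norm
  refine h.congr (Eventually.of_forall fun x => ?_)
  simp [Complex.norm_exp, ← Complex.ofReal_pow]

lemma integrable_stdGaussianDensity : Integrable (stdGaussianDensity (E := E)) :=
  (integrable_exp_neg_mul_sq_norm (by norm_num)).const_mul _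

lemma integral_stdGaussianDensity_smul_cexp_inner (t : E) :
    ∫ x : E, stdGaussianDensity x • Complex.exp (⟪x, t⟫ * Complex.I) =
      Complex.exp (-‖t‖ ^ 2 / 2) := by
  set Z : ℝ := (2 * π) ^ (finrank ℝ E / 2 : ℝ) with hZ
  have hZ0 : Z ≠ 0 := (Real.rpow_pos_of_pos (by positivity) _).ne'
  have hFourier := GaussianFourier.integral_cexp_neg_mul_sq_norm_add (V := E) (b := 1 / 2)
    (by norm_num) Complex.I t
  have hconst : ((π : ℂ) / (1 / 2)) ^ ((finrank ℝ E : ℂ) / 2) = Z := by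
    rw [hZ, Complex.ofReal_cpow (by positivity)]
    push_cast
    ring_nf
  calc ∫ x : E, stdGaussianDensity x • Complex.exp (⟪x, t⟫ * Complex.I)
      = ∫ x : E, (Z⁻¹ : ℝ) * Complex.exp (-(1 / 2) * ‖x‖ ^ 2 + Complex.I * ⟪t, x⟫) := by
        congr with x
        rw [stdGaussianDensity, ← hZ, Complex.real_smul, Complex.exp_add, real_inner_comm]
        push_cast
        ring_nf
    _ = (Z⁻¹ * Z : ℝ) * Complex.exp (-‖t‖ ^ 2 / 2) := by
        rw [integral_const_mul, hFourier, hconst, ← mul_assoc, ← Complex.ofReal_mul, Complex.I_sq]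
        ring_nf
    _ = Complex.exp (-‖t‖ ^ 2 / 2) := by simp [hZ0]

theorem stdGaussian_eq_withDensity :
    stdGaussian E = volume.withDensity fun x => ENNReal.ofReal (stdGaussianDensity x) := by
  have : IsFiniteMeasure (volume.withDensity
      fun x : E => ENNReal.ofReal (stdGaussianDensity x)) :=
    isFiniteMeasure_withDensity_ofReal integrable_stdGaussianDensity.2
  refine Measure.ext_of_charFun (funext fun t => ?_)
  rw [charFun_stdGaussian, charFun_apply, integral_withDensity_eq_integral_toReal_smul
    continuous_stdGaussianDensity.measurable.ennreal_ofReal (by simp)]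
  simp_rw [ENNReal.toReal_ofReal (stdGaussianDensity_pos _).le]
  exact (integral_stdGaussianDensity_smul_cexp_inner t).symm

variable {G : Type*} [NormedAddCommGroup G] [NormedSpace ℝ G]

lemma integral_stdGaussian_eq_integral_smul (f : E → G) :
    ∫ x, f x ∂stdGaussian E = ∫ x, stdGaussianDensity x • f x := by
  rw [stdGaussian_eq_withDensity, integral_withDensity_eq_integral_toReal_smul
    continuous_stdGaussianDensity.measurable.ennreal_ofReal (by simp)]
  simp_rw [ENNReal.toReal_ofReal (stdGaussianDensity_pos _).le]

lemma integrable_stdGaussian_iff_integrable_smul {f : E → G} :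
    Integrable f (stdGaussian E) ↔ Integrable fun x => stdGaussianDensity x • f x := by
  rw [stdGaussian_eq_withDensity, integrable_withDensity_iff_integrable_smul'
    continuous_stdGaussianDensity.measurable.ennreal_ofReal (by simp)]
  simp_rw [ENNReal.toReal_ofReal (stdGaussianDensity_pos _).le]

/-- **Stein's identity**. -/
theorem integral_inner_smul_stdGaussian {f f' : E → G} {c : E}
    (hf : ∀ x, HasLineDerivAt ℝ f (f' x) x c) (hfi : Integrable f (stdGaussian E))
    (hf'i : Integrable f' (stdGaussian E))
    (hcfi : Integrable (fun x => ⟪c, x⟫ • f x) (stdGaussian E)) :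
    ∫ x, ⟪c, x⟫ • f x ∂stdGaussian E = ∫ x, f' x ∂stdGaussian E := by
  rw [integrable_stdGaussian_iff_integrable_smul] at hfi hf'i hcfi
  rw [integral_stdGaussian_eq_integral_smul, integral_stdGaussian_eq_integral_smul]
  have hparts := integral_bilinear_hasLineDerivAt_right_eq_neg_left_of_integrable (μ := volume)
    (B := ContinuousLinearMap.lsmul ℝ ℝ) (by simpa [mul_smul] using hcfi.neg) (by simpa using hf'i)
    (by simpa using hfi) (fun x _ => hasLineDerivAt_stdGaussianDensity x c) (fun x _ => hf x)
  simpa [mul_smul, integral_neg] using hparts.symm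

end Density

section ExponentialMoments

variable {E : Type*} [NormedAddCommGroup E] [InnerProductSpace ℝ E] [FiniteDimensional ℝ E]
  [MeasurableSpace E] [BorelSpace E]

lemma integrable_exp_mul_sq_norm_stdGaussian {s : ℝ} (hs : s < 1) :
    Integrable (fun x : E => exp (s / 2 * ‖x‖ ^ 2)) (stdGaussian E) := by
  simp_rw [integrable_stdGaussian_iff_integrable_smul, smul_eq_mul,
    exp_mul_sq_norm_mul_stdGaussianDensity]
  exact (integrable_exp_neg_mul_sq_norm (by linarith)).const_mul _

lemma integral_exp_mul_sq_norm_stdGaussian {s : ℝ} (hs : s < 1) :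
    ∫ x : E, exp (s / 2 * ‖x‖ ^ 2) ∂stdGaussian E = (1 - s)⁻¹ ^ (finrank ℝ E / 2 : ℝ) := by
  have hs' : 0 < 1 - s := by linarith
  simp_rw [integral_stdGaussian_eq_integral_smul, smul_eq_mul,
    exp_mul_sq_norm_mul_stdGaussianDensity]
  rw [integral_const_mul, GaussianFourier.integral_rexp_neg_mul_sq_norm (by linarith),
    show π / ((1 - s) / 2) = 2 * π * (1 - s)⁻¹ by field_simp,
    Real.mul_rpow (x := 2 * π) (by positivity) (by positivity),
    inv_mul_cancel_left₀ (by positivity)]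

lemma exp_mul_le_exp_mul_exp_sq {s : ℝ} (hs : 0 < s) (l r : ℝ) :
    exp (l * r) ≤ exp (l ^ 2 / (2 * s)) * exp (s / 2 * r ^ 2) := by
  rw [← Real.exp_add, Real.exp_le_exp]
  have hsq : l ^ 2 / (2 * s) + s / 2 * r ^ 2 - l * r = (l - s * r) ^ 2 / (2 * s) := by
    field_simp; ring
  have : 0 ≤ (l - s * r) ^ 2 / (2 * s) := by positivity
  linarith

lemma integrable_exp_mul_norm_stdGaussian (l : ℝ) :
    Integrable (fun x : E => exp (l * ‖x‖)) (stdGaussian E) := by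
  refine ((integrable_exp_mul_sq_norm_stdGaussian (s := 1 / 2) (by norm_num)).const_mul
    (exp (l ^ 2 / (2 * (1 / 2))))).mono' (by fun_prop) (Eventually.of_forall fun x => ?_)
  rw [Real.norm_of_nonneg (exp_pos _).le]
  exact exp_mul_le_exp_mul_exp_sq (by norm_num) _ _

lemma integrable_stdGaussian_of_abs_le_exp {f : E → ℝ} (hf : Continuous f) {K R : ℝ}
    (h : ∀ x, |f x| ≤ K * exp (R * ‖x‖)) : Integrable f (stdGaussian E) :=
  ((integrable_exp_mul_norm_stdGaussian R).const_mul K).mono' hf.aestronglyMeasurable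
    (Eventually.of_forall h)

lemma integral_exp_mul_norm_stdGaussian_le_of_lt_one (l : ℝ) {s : ℝ} (hs0 : 0 < s) (hs1 : s < 1) :
    ∫ x : E, exp (l * ‖x‖) ∂stdGaussian E ≤
      exp (l ^ 2 / (2 * s)) * (1 - s)⁻¹ ^ (finrank ℝ E / 2 : ℝ) := by
  rw [← integral_exp_mul_sq_norm_stdGaussian hs1, ← integral_const_mul]
  exact integral_mono (integrable_exp_mul_norm_stdGaussian l)
    ((integrable_exp_mul_sq_norm_stdGaussian hs1).const_mul _)
    fun x => exp_mul_le_exp_mul_exp_sq hs0 l ‖x‖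

theorem integral_exp_mul_norm_stdGaussian_le {l : ℝ} (hl : 0 ≤ l) :
    ∫ x : E, exp (l * ‖x‖) ∂stdGaussian E ≤ exp (l * √(finrank ℝ E) + l ^ 2 / 2) := by
  rcases hl.eq_or_lt with rfl | hl
  · simp
  rcases subsingleton_or_nontrivial E with hE | hE
  · have hnorm : ∀ x : E, ‖x‖ = 0 := fun x => by rw [Subsingleton.elim x 0, norm_zero]
    simpa [hnorm] using show 0 ≤ l * √(finrank ℝ E) + l ^ 2 / 2 by positivity
  set q := √(finrank ℝ E : ℝ)
  have hq0 : 0 < q := Real.sqrt_pos.2 (by exact_mod_cast finrank_pos)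
  have hdim : (finrank ℝ E : ℝ) = q ^ 2 := (Real.sq_sqrt (Nat.cast_nonneg _)).symm
  have hinv : (1 - l / (q + l))⁻¹ = 1 + l / q := by
    field_simp
    rw [add_sub_cancel_right]
    field_simp
  -- `s = l / (q + l)` minimizes the bound once `1 + r ≤ exp r` is used with `r = s / (1 - s)`.
  calc ∫ x : E, exp (l * ‖x‖) ∂stdGaussian E
      ≤ exp (l ^ 2 / (2 * (l / (q + l)))) * (1 + l / q) ^ (finrank ℝ E / 2 : ℝ) := by
        rw [← hinv]
        exact integral_exp_mul_norm_stdGaussian_le_of_lt_one l (by positivity)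
          ((div_lt_one (by positivity)).2 (by linarith))
    _ ≤ exp (l ^ 2 / (2 * (l / (q + l)))) * exp (l / q) ^ (finrank ℝ E / 2 : ℝ) := by
        gcongr
        linarith [Real.add_one_le_exp (l / q)]
    _ = exp (l * q + l ^ 2 / 2) := by
        rw [← Real.exp_mul, ← Real.exp_add, hdim]
        congr 1
        field_simp
        ring

lemma stdGaussian_real : stdGaussian ℝ = gaussianReal 0 1 := by
  refine Measure.ext_of_charFun (funext fun t => ?_)
  rw [charFun_stdGaussian, charFun_gaussianReal, ← Complex.ofReal_pow, Real.norm_eq_abs, sq_abs]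
  push_cast
  ring_nf

lemma integral_exp_mul_stdGaussian_real (l : ℝ) :
    ∫ y : ℝ, exp (l * y) ∂stdGaussian ℝ = exp (l ^ 2 / 2) := by
  rw [stdGaussian_real]
  simpa [mgf] using congrFun (mgf_id_gaussianReal (μ := 0) (v := 1)) l

end ExponentialMoments

section Products

variable {E : Type*} [NormedAddCommGroup E] [InnerProductSpace ℝ E] [FiniteDimensional ℝ E]
  [MeasurableSpace E] [BorelSpace E]
  {F : Type*} [NormedAddCommGroup F] [InnerProductSpace ℝ F] [FiniteDimensional ℝ F]
  [MeasurableSpace F] [BorelSpace F]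

lemma map_toLp_prod_stdGaussian :
    ((stdGaussian E).prod (stdGaussian F)).map (WithLp.toLp 2) =
      stdGaussian (WithLp 2 (E × F)) := by
  refine Measure.ext_of_charFun (funext fun t => ?_)
  rw [charFun_prod, charFun_stdGaussian, charFun_stdGaussian, charFun_stdGaussian,
    ← Complex.exp_add, ← Complex.ofReal_pow ‖t‖, WithLp.prod_norm_sq_eq_of_L2]
  push_cast
  ring_nf
  rfl

lemma map_toLp_pi_stdGaussian {τ : Type*} [Fintype τ] :
    (Measure.pi fun _ : τ => stdGaussian E).map (WithLp.toLp 2) =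
      stdGaussian (PiLp 2 fun _ : τ => E) := by
  refine Measure.ext_of_charFun (funext fun t => ?_)
  rw [charFun_pi, charFun_stdGaussian, ← Complex.ofReal_pow, PiLp.norm_sq_eq_of_L2]
  simp_rw [charFun_stdGaussian, ← Complex.exp_sum, ← Finset.sum_div, Finset.sum_neg_distrib]
  push_cast
  rfl

variable {𝕜 : Type*} [RCLike 𝕜]

lemma integral_stdGaussian_prod_mul (f : E → 𝕜) (g : F → 𝕜) :
    ∫ x, f x.fst * g x.snd ∂stdGaussian (WithLp 2 (E × F)) =
      (∫ x, f x ∂stdGaussian E) * ∫ x, g x ∂stdGaussian F := by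
  rw [← map_toLp_prod_stdGaussian, ← MeasurableEquiv.coe_toLp, integral_map_equiv]
  simpa using integral_prod_mul f g

lemma integral_stdGaussian_fst (f : E → 𝕜) :
    ∫ x, f x.fst ∂stdGaussian (WithLp 2 (E × F)) = ∫ x, f x ∂stdGaussian E := by
  simpa using integral_stdGaussian_prod_mul (F := F) f 1

lemma integral_stdGaussian_snd (f : F → 𝕜) :
    ∫ x, f x.snd ∂stdGaussian (WithLp 2 (E × F)) = ∫ x, f x ∂stdGaussian F := by
  simpa using integral_stdGaussian_prod_mul (E := E) 1 f

lemma integrable_stdGaussian_prod_mul {f : E → 𝕜} {g : F → 𝕜} (hf : Integrable f (stdGaussian E))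
    (hg : Integrable g (stdGaussian F)) :
    Integrable (fun x => f x.fst * g x.snd) (stdGaussian (WithLp 2 (E × F))) := by
  rw [← map_toLp_prod_stdGaussian, ← MeasurableEquiv.coe_toLp, integrable_map_equiv]
  exact hf.mul_prod hg

lemma map_inv_smul_multivariateGaussian {ι : Type*} [Fintype ι] [DecidableEq ι] {σ : ℝ}
    (hσ : σ ≠ 0) :
    (multivariateGaussian 0 (σ ^ 2 • (1 : Matrix ι ι ℝ))).map (σ⁻¹ • ·) =
      stdGaussian (EuclideanSpace ℝ ι) := by
  have hS : (σ ^ 2 • (1 : Matrix ι ι ℝ)).PosSemidef := Matrix.PosSemidef.one.smul (sq_nonneg σ)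
  refine Measure.ext_of_charFun (funext fun t => ?_)
  rw [charFun_map_smul, charFun_multivariateGaussian hS, charFun_stdGaussian]
  have hvar : (σ⁻¹ • t).ofLp ⬝ᵥ (σ ^ 2 • (1 : Matrix ι ι ℝ)) *ᵥ (σ⁻¹ • t).ofLp = ‖t‖ ^ 2 := by
    rw [EuclideanSpace.real_norm_sq_eq]
    simp only [Matrix.smul_mulVec, Matrix.one_mulVec, dotProduct, PiLp.smul_apply, Pi.smul_apply,
      WithLp.ofLp_smul, smul_eq_mul]
    refine Finset.sum_congr rfl fun i _ => ?_
    field_simp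
  rw [hvar]
  simp [neg_div]

end Products

section SmoothMaximum

variable {ι : Type*} [Fintype ι] {p : ℝ}

/-- The smooth approximation `(∑ i, exp (s i / p)) ^ p` at temperature `p > 0` of the maximum of the
numbers `exp (s i)`; the two differ by a factor of at most `(card ι) ^ p`. -/
noncomputable def expSmoothMax (p : ℝ) (s : ι → ℝ) : ℝ :=
  (∑ i, exp (s i / p)) ^ p

/-- The Gibbs weights `exp (s i / p) / ∑ j, exp (s j / p)` at temperature `p > 0`; they are the
partial derivatives of the logarithm of `expSmoothMax p`. -/
noncomputable def gibbsWeight (p : ℝ) (s : ι → ℝ) (i : ι) : ℝ :=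
  exp (s i / p) / ∑ j, exp (s j / p)

lemma expSmoothMax_nonneg (p : ℝ) (s : ι → ℝ) : 0 ≤ expSmoothMax p s := by
  unfold expSmoothMax; positivity

lemma exp_le_expSmoothMax (hp : 0 < p) (s : ι → ℝ) (i : ι) : exp (s i) ≤ expSmoothMax p s := by
  calc exp (s i) = exp (s i / p) ^ p := by rw [← Real.exp_mul, div_mul_cancel₀ _ hp.ne']
    _ ≤ expSmoothMax p s := Real.rpow_le_rpow (exp_pos _).le
        (Finset.single_le_sum (f := fun i => exp (s i / p)) (fun _ _ => (exp_pos _).le)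
          (Finset.mem_univ i)) hp.le

lemma expSmoothMax_le (hp : 0 < p) {s : ι → ℝ} {B : ℝ} (hs : ∀ i, s i ≤ B) :
    expSmoothMax p s ≤ (Fintype.card ι : ℝ) ^ p * exp B := by
  calc expSmoothMax p s ≤ (∑ _i : ι, exp (B / p)) ^ p := by
        unfold expSmoothMax; gcongr with i; exact hs i
    _ = (Fintype.card ι : ℝ) ^ p * exp B := by
        rw [Finset.sum_const, Finset.card_univ, nsmul_eq_mul, Real.mul_rpow (by positivity)
          (exp_pos _).le, ← Real.exp_mul, div_mul_cancel₀ _ hp.ne']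

lemma expSmoothMax_add_const (hp : p ≠ 0) (s : ι → ℝ) (r : ℝ) :
    expSmoothMax p (fun i => s i + r) = expSmoothMax p s * exp r := by
  simp_rw [expSmoothMax, add_div, Real.exp_add, ← Finset.sum_mul]
  rw [Real.mul_rpow (by positivity) (exp_pos _).le, ← Real.exp_mul, div_mul_cancel₀ _ hp]

lemma gibbsWeight_nonneg (p : ℝ) (s : ι → ℝ) (i : ι) : 0 ≤ gibbsWeight p s i := by
  unfold gibbsWeight; positivity

lemma gibbsWeight_le_one (p : ℝ) (s : ι → ℝ) (i : ι) : gibbsWeight p s i ≤ 1 :=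
  div_le_one_of_le₀ (Finset.single_le_sum (f := fun i => exp (s i / p))
    (fun _ _ => (exp_pos _).le) (Finset.mem_univ i)) (by positivity)

lemma sum_gibbsWeight_le_one (p : ℝ) (s : ι → ℝ) : ∑ i, gibbsWeight p s i ≤ 1 := by
  simp_rw [gibbsWeight, ← Finset.sum_div]
  exact div_self_le_one _

lemma abs_sum_gibbsWeight_mul_le (p : ℝ) (s : ι → ℝ) {r : ι → ℝ} {B : ℝ} (hB : 0 ≤ B)
    (hr : ∀ i, |r i| ≤ B) : |∑ i, gibbsWeight p s i * r i| ≤ B := by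
  calc |∑ i, gibbsWeight p s i * r i| ≤ ∑ i, gibbsWeight p s i * B := by
        refine (Finset.abs_sum_le_sum_abs _ _).trans (Finset.sum_le_sum fun i _ => ?_)
        rw [abs_mul, abs_of_nonneg (gibbsWeight_nonneg p s i)]
        exact mul_le_mul_of_nonneg_left (hr i) (gibbsWeight_nonneg p s i)
    _ ≤ B := by
        rw [← Finset.sum_mul]
        exact mul_le_of_le_one_left hB (sum_gibbsWeight_le_one p s)

lemma sum_exp_pos [Nonempty ι] (s : ι → ℝ) : 0 < ∑ i, exp (s i) :=
  Finset.sum_pos (fun _ _ => exp_pos _) Finset.univ_nonempty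

lemma continuous_expSmoothMax (hp : 0 ≤ p) : Continuous (expSmoothMax (ι := ι) p) :=
  Continuous.rpow_const (by fun_prop) fun _ => Or.inr hp

lemma continuous_gibbsWeight (p : ℝ) (i : ι) : Continuous fun s : ι → ℝ => gibbsWeight p s i := by
  have : Nonempty ι := ⟨i⟩
  exact Continuous.div (by fun_prop) (by fun_prop) fun s => (sum_exp_pos _).ne'

section Derivative

variable {s : ℝ → ι → ℝ} {s' : ι → ℝ} {θ : ℝ}

lemma hasDerivAt_sum_exp_div (hs : ∀ i, HasDerivAt (fun θ => s θ i) (s' i) θ) (p : ℝ) :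
    HasDerivAt (fun θ => ∑ i, exp (s θ i / p))
      ((∑ i, exp (s θ i / p)) * (∑ i, gibbsWeight p (s θ) i * s' i) / p) θ := by
  rcases isEmpty_or_nonempty ι with _ | _
  · simpa using hasDerivAt_const θ (0 : ℝ)
  convert! HasDerivAt.fun_sum fun i (_ : i ∈ Finset.univ) => ((hs i).div_const p).exp using 1
  have := sum_exp_pos fun i => s θ i / p
  rw [Finset.mul_sum, Finset.sum_div]
  refine Finset.sum_congr rfl fun i _ => ?_
  unfold gibbsWeight
  field_simp

lemma hasDerivAt_expSmoothMax (hp : p ≠ 0) (hs : ∀ i, HasDerivAt (fun θ => s θ i) (s' i) θ) :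
    HasDerivAt (fun θ => expSmoothMax p (s θ))
      (expSmoothMax p (s θ) * ∑ i, gibbsWeight p (s θ) i * s' i) θ := by
  rcases isEmpty_or_nonempty ι with _ | _
  · simpa [expSmoothMax] using hasDerivAt_const θ _
  have hpos := sum_exp_pos fun i => s θ i / p
  convert! (hasDerivAt_sum_exp_div hs p).rpow_const (p := p) (Or.inl hpos.ne') using 1
  rw [expSmoothMax, Real.rpow_sub_one hpos.ne']
  field_simp

lemma hasDerivAt_gibbsWeight (hs : ∀ i, HasDerivAt (fun θ => s θ i) (s' i) θ) (p : ℝ) (i : ι) :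
    HasDerivAt (fun θ => gibbsWeight p (s θ) i)
      (gibbsWeight p (s θ) i * (s' i - ∑ j, gibbsWeight p (s θ) j * s' j) / p) θ := by
  have : Nonempty ι := ⟨i⟩
  have hpos := sum_exp_pos fun i => s θ i / p
  convert! ((hs i).div_const p).exp.div (hasDerivAt_sum_exp_div hs p) hpos.ne' using 1
  simp only [gibbsWeight]
  field_simp

end Derivative

end SmoothMaximum

section Rotate

/-- The point at angle `θ` on the arc from `a` (at `θ = 0`) to `b` (at `θ = π / 2`). In Slepian's
inequality it interpolates between two families of coefficient vectors. -/
noncomputable def rotate {V : Type*} [AddCommGroup V] [Module ℝ V] (a b : V) (θ : ℝ) : V :=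
  cos θ • a + sin θ • b

variable {V : Type*} [NormedAddCommGroup V] [NormedSpace ℝ V]

lemma hasDerivAt_rotate (a b : V) (θ : ℝ) : HasDerivAt (rotate a b) (rotate b (-a) θ) θ := by
  convert! ((hasDerivAt_cos θ).smul_const a).add ((hasDerivAt_sin θ).smul_const b) using 1
  simp [rotate, add_comm]

lemma norm_rotate_le (a b : V) (θ : ℝ) : ‖rotate a b θ‖ ≤ ‖a‖ + ‖b‖ := by
  refine (norm_add_le _ _).trans (add_le_add ?_ ?_)
  · rw [norm_smul]
    exact mul_le_of_le_one_left (norm_nonneg a) (abs_cos_le_one θ)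
  · rw [norm_smul]
    exact mul_le_of_le_one_left (norm_nonneg b) (abs_sin_le_one θ)

lemma inner_rotate_rotate_neg {ι E : Type*} [NormedAddCommGroup E] [InnerProductSpace ℝ E]
    {a b : ι → E} (hab : ∀ i j, ⟪a i, b j⟫ = 0) (θ : ℝ) (i j : ι) :
    ⟪rotate a b θ j, rotate b (-a) θ i⟫ = sin θ * cos θ * (⟪b j, b i⟫ - ⟪a j, a i⟫) := by
  have hba : ⟪b j, a i⟫ = 0 := by rw [real_inner_comm, hab]
  simp only [rotate, Pi.add_apply, Pi.smul_apply, Pi.neg_apply, inner_add_left, inner_add_right,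
    real_inner_smul_left, real_inner_smul_right, inner_neg_right, hab, hba]
  ring

end Rotate

section Slepian

variable {ι : Type*} [Fintype ι] {p : ℝ}
  {E : Type*} [NormedAddCommGroup E] [InnerProductSpace ℝ E]

lemma expSmoothMax_inner_le (hp : 0 < p) {c : ι → E} {R : ℝ} (hc : ‖c‖ ≤ R) (x : E) :
    expSmoothMax p (fun i => ⟪c i, x⟫) ≤ (Fintype.card ι : ℝ) ^ p * exp (R * ‖x‖) :=
  expSmoothMax_le hp fun i => (real_inner_le_norm _ _).trans
    (mul_le_mul_of_nonneg_right ((norm_le_pi_norm c i).trans hc) (norm_nonneg x))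

lemma mul_expSmoothMax_inner_le (hp : 0 < p) {c : ι → E} {R : ℝ} (hc : ‖c‖ ≤ R) (x : E) :
    R * ‖x‖ * expSmoothMax p (fun i => ⟪c i, x⟫) ≤
      R * (Fintype.card ι : ℝ) ^ p * exp ((R + 1) * ‖x‖) := by
  have hR : 0 ≤ R := (norm_nonneg c).trans hc
  calc R * ‖x‖ * expSmoothMax p (fun i => ⟪c i, x⟫)
      ≤ R * exp ‖x‖ * ((Fintype.card ι : ℝ) ^ p * exp (R * ‖x‖)) := by
        gcongr
        · exact expSmoothMax_nonneg _ _
        · linarith [Real.add_one_le_exp ‖x‖]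
        · exact expSmoothMax_inner_le hp hc x
    _ = R * (Fintype.card ι : ℝ) ^ p * exp ((R + 1) * ‖x‖) := by
        rw [add_one_mul, Real.exp_add]
        ring

lemma continuous_expSmoothMax_inner (hp : 0 ≤ p) (c : ι → E) :
    Continuous fun x => expSmoothMax p fun i => ⟪c i, x⟫ :=
  (continuous_expSmoothMax hp).comp
    (continuous_pi fun i => by fun_prop : Continuous fun x i => ⟪c i, x⟫)

lemma continuous_gibbsWeight_inner (p : ℝ) (c : ι → E) (i : ι) :
    Continuous fun x => gibbsWeight p (fun j => ⟪c j, x⟫) i :=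
  (continuous_gibbsWeight p i).comp
    (continuous_pi fun j => by fun_prop : Continuous fun x j => ⟪c j, x⟫)

lemma hasDerivAt_inner_add_smul (c x v : E) :
    HasDerivAt (fun r : ℝ => ⟪c, x + r • v⟫) ⟪c, v⟫ 0 := by
  simpa using! ((innerSL ℝ c).hasFDerivAt (x := x)).hasLineDerivAt v

lemma hasLineDerivAt_expSmoothMax_mul_gibbsWeight_inner (hp : p ≠ 0) (c : ι → E) (i : ι)
    (x v : E) :
    HasLineDerivAt ℝ
      (fun x => expSmoothMax p (fun j => ⟪c j, x⟫) * gibbsWeight p (fun j => ⟪c j, x⟫) i)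
      (expSmoothMax p (fun j => ⟪c j, x⟫) * gibbsWeight p (fun j => ⟪c j, x⟫) i *
        (⟪c i, v⟫ / p - (1 / p - 1) * ∑ j, gibbsWeight p (fun j => ⟪c j, x⟫) j * ⟪c j, v⟫))
      x v := by
  have hline := fun j => hasDerivAt_inner_add_smul (c j) x v
  have h := (hasDerivAt_expSmoothMax hp hline).mul (hasDerivAt_gibbsWeight hline p i)
  simp only [zero_smul, add_zero] at h
  refine HasDerivAt.congr_deriv h ?_
  field_simp
  ring

variable [MeasurableSpace E] [BorelSpace E]

lemma integrable_mul_gibbsWeight_inner [SecondCountableTopology E] {μ : Measure E} {f : E → ℝ}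
    (hf : Integrable f μ) (p : ℝ) (c : ι → E) (i : ι) :
    Integrable (fun x => f x * gibbsWeight p (fun j => ⟪c j, x⟫) i) μ :=
  hf.mul_bdd (c := 1) (continuous_gibbsWeight_inner p c i).aestronglyMeasurable
    (Eventually.of_forall fun x => by
      rw [Real.norm_of_nonneg (gibbsWeight_nonneg _ _ _)]
      exact gibbsWeight_le_one _ _ _)

variable [FiniteDimensional ℝ E]

lemma integrable_expSmoothMax_inner (hp : 0 < p) (c : ι → E) :
    Integrable (fun x => expSmoothMax p fun i => ⟪c i, x⟫) (stdGaussian E) :=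
  integrable_stdGaussian_of_abs_le_exp (continuous_expSmoothMax_inner hp.le c) fun x => by
    rw [abs_of_nonneg (expSmoothMax_nonneg _ _)]
    exact expSmoothMax_inner_le hp le_rfl x

lemma integrable_inner_mul_expSmoothMax_inner (hp : 0 < p) (c : ι → E) (v : E) :
    Integrable (fun x => ⟪v, x⟫ * expSmoothMax p fun i => ⟪c i, x⟫) (stdGaussian E) := by
  have := continuous_expSmoothMax_inner hp.le c
  refine integrable_stdGaussian_of_abs_le_exp (by fun_prop) fun x =>
    le_trans ?_ (mul_expSmoothMax_inner_le hp (le_max_left ‖c‖ ‖v‖) x)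
  rw [abs_mul, abs_of_nonneg (expSmoothMax_nonneg _ _)]
  gcongr
  · exact expSmoothMax_nonneg _ _
  · exact (abs_real_inner_le_norm v x).trans (by gcongr; exact le_max_right _ _)

lemma integral_inner_mul_expSmoothMax_mul_gibbsWeight (hp : 0 < p) (c : ι → E) (v : E) (i : ι) :
    ∫ x, ⟪v, x⟫ * (expSmoothMax p (fun j => ⟪c j, x⟫) * gibbsWeight p (fun j => ⟪c j, x⟫) i)
        ∂stdGaussian E =
      ∫ x, expSmoothMax p (fun j => ⟪c j, x⟫) * gibbsWeight p (fun j => ⟪c j, x⟫) i *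
        (⟪c i, v⟫ / p - (1 / p - 1) * ∑ j, gibbsWeight p (fun j => ⟪c j, x⟫) j * ⟪c j, v⟫)
        ∂stdGaussian E := by
  have hint := integrable_mul_gibbsWeight_inner (integrable_expSmoothMax_inner hp c) p c i
  refine integral_inner_smul_stdGaussian
    (fun x => hasLineDerivAt_expSmoothMax_mul_gibbsWeight_inner hp.ne' c i x v) hint ?_ ?_
  · simp_rw [mul_sub, Finset.mul_sum]
    refine (hint.mul_const _).sub (integrable_finsetSum _ fun j _ => ?_)
    refine ((integrable_mul_gibbsWeight_inner hint p c j).const_mul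
      ((1 / p - 1) * ⟪c j, v⟫)).congr (Eventually.of_forall fun x => ?_)
    ring
  · simp_rw [smul_eq_mul, ← mul_assoc]
    exact integrable_mul_gibbsWeight_inner (integrable_inner_mul_expSmoothMax_inner hp c v) p c i

lemma integral_expSmoothMax_mul_sum_gibbsWeight_nonneg (hp0 : 0 < p) (hp1 : p ≤ 1) {c c' : ι → E}
    (hself : ∀ i, ⟪c i, c' i⟫ = 0) (hle : ∀ i j, ⟪c j, c' i⟫ ≤ 0) :
    0 ≤ ∫ x, expSmoothMax p (fun j => ⟪c j, x⟫) *
      ∑ i, gibbsWeight p (fun j => ⟪c j, x⟫) i * ⟪c' i, x⟫ ∂stdGaussian E := by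
  have hint : ∀ i, Integrable (fun x => ⟪c' i, x⟫ * (expSmoothMax p (fun j => ⟪c j, x⟫) *
      gibbsWeight p (fun j => ⟪c j, x⟫) i)) (stdGaussian E) := fun i => by
    simp_rw [← mul_assoc]
    exact integrable_mul_gibbsWeight_inner
      (integrable_inner_mul_expSmoothMax_inner hp0 c (c' i)) p c i
  calc (0 : ℝ) ≤ ∑ i, ∫ x, ⟪c' i, x⟫ * (expSmoothMax p (fun j => ⟪c j, x⟫) *
        gibbsWeight p (fun j => ⟪c j, x⟫) i) ∂stdGaussian E := by
        refine Finset.sum_nonneg fun i _ => ?_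
        rw [integral_inner_mul_expSmoothMax_mul_gibbsWeight hp0 c (c' i) i]
        refine integral_nonneg fun x => mul_nonneg
          (mul_nonneg (expSmoothMax_nonneg _ _) (gibbsWeight_nonneg _ _ _)) ?_
        have hp : 0 ≤ 1 / p - 1 := sub_nonneg.2 ((one_le_div₀ hp0).2 hp1)
        rw [hself, zero_div, zero_sub, neg_nonneg]
        exact mul_nonpos_of_nonneg_of_nonpos hp (Finset.sum_nonpos fun j _ =>
          mul_nonpos_of_nonneg_of_nonpos (gibbsWeight_nonneg _ _ _) (hle i j))
    _ = _ := by
        rw [← integral_finsetSum _ fun i _ => hint i]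
        congr with x
        rw [Finset.mul_sum]
        exact Finset.sum_congr rfl fun i _ => by ring

lemma hasDerivAt_integral_expSmoothMax_inner (hp : 0 < p) {c c' : ℝ → ι → E} {R : ℝ}
    (hderiv : ∀ θ, HasDerivAt c (c' θ) θ) (hc : ∀ θ, ‖c θ‖ ≤ R) (hc' : ∀ θ, ‖c' θ‖ ≤ R) (θ : ℝ) :
    HasDerivAt (fun θ => ∫ x, expSmoothMax p (fun i => ⟪c θ i, x⟫) ∂stdGaussian E)
      (∫ x, expSmoothMax p (fun j => ⟪c θ j, x⟫) *
        ∑ i, gibbsWeight p (fun j => ⟪c θ j, x⟫) i * ⟪c' θ i, x⟫ ∂stdGaussian E) θ := by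
  have hpoint : ∀ θ x, HasDerivAt (fun θ => expSmoothMax p fun i => ⟪c θ i, x⟫)
      (expSmoothMax p (fun j => ⟪c θ j, x⟫) *
        ∑ i, gibbsWeight p (fun j => ⟪c θ j, x⟫) i * ⟪c' θ i, x⟫) θ := fun θ x =>
    hasDerivAt_expSmoothMax hp.ne' fun i => by
      simpa using (hasDerivAt_pi.1 (hderiv θ) i).inner ℝ (hasDerivAt_const θ x)
  have hsum : ∀ θ x, |∑ i, gibbsWeight p (fun j => ⟪c θ j, x⟫) i * ⟪c' θ i, x⟫| ≤ R * ‖x‖ :=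
    fun θ x => abs_sum_gibbsWeight_mul_le _ _
      (mul_nonneg ((norm_nonneg _).trans (hc θ)) (norm_nonneg x)) fun i =>
      (abs_real_inner_le_norm _ _).trans
        (mul_le_mul_of_nonneg_right ((norm_le_pi_norm _ i).trans (hc' θ)) (norm_nonneg x))
  have hcont : Continuous fun x => expSmoothMax p (fun j => ⟪c θ j, x⟫) *
      ∑ i, gibbsWeight p (fun j => ⟪c θ j, x⟫) i * ⟪c' θ i, x⟫ := by
    have := continuous_expSmoothMax_inner hp.le (c θ)
    have := continuous_gibbsWeight_inner p (c θ)
    fun_prop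
  refine (hasDerivAt_integral_of_dominated_loc_of_deriv_le
    (bound := fun x => R * (Fintype.card ι : ℝ) ^ p * exp ((R + 1) * ‖x‖)) univ_mem
    (Eventually.of_forall fun θ => (continuous_expSmoothMax_inner hp.le (c θ)).aestronglyMeasurable)
    (integrable_expSmoothMax_inner hp (c θ)) hcont.aestronglyMeasurable
    (Eventually.of_forall fun x θ _ => ?_)
    ((integrable_exp_mul_norm_stdGaussian (R + 1)).const_mul _)
    (Eventually.of_forall fun x θ _ => hpoint θ x)).2
  rw [Real.norm_eq_abs, abs_mul, abs_of_nonneg (expSmoothMax_nonneg _ _), mul_comm]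
  exact (mul_le_mul_of_nonneg_right (hsum θ x) (expSmoothMax_nonneg _ _)).trans
    (mul_expSmoothMax_inner_le hp (hc θ) x)

lemma monotoneOn_integral_expSmoothMax_inner (hp0 : 0 < p) (hp1 : p ≤ 1) {c c' : ℝ → ι → E}
    {R : ℝ} {S : Set ℝ} (hS : Convex ℝ S) (hderiv : ∀ θ, HasDerivAt c (c' θ) θ)
    (hc : ∀ θ, ‖c θ‖ ≤ R) (hc' : ∀ θ, ‖c' θ‖ ≤ R)
    (hself : ∀ θ ∈ interior S, ∀ i, ⟪c θ i, c' θ i⟫ = 0)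
    (hle : ∀ θ ∈ interior S, ∀ i j, ⟪c θ j, c' θ i⟫ ≤ 0) :
    MonotoneOn (fun θ => ∫ x, expSmoothMax p (fun i => ⟪c θ i, x⟫) ∂stdGaussian E) S := by
  have hd := hasDerivAt_integral_expSmoothMax_inner hp0 hderiv hc hc'
  refine monotoneOn_of_deriv_nonneg hS (fun θ _ => (hd θ).continuousAt.continuousWithinAt)
    (fun θ _ => (hd θ).differentiableAt.differentiableWithinAt) fun θ hθ => ?_
  rw [(hd θ).deriv]
  exact integral_expSmoothMax_mul_sum_gibbsWeight_nonneg hp0 hp1 (hself θ hθ) (hle θ hθ)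

lemma integral_expSmoothMax_inner_le_of_orthogonal (hp0 : 0 < p) (hp1 : p ≤ 1) {a b : ι → E}
    (hab : ∀ i j, ⟪a i, b j⟫ = 0) (hnorm : ∀ i, ‖a i‖ = ‖b i‖)
    (hle : ∀ i j, ⟪b i, b j⟫ ≤ ⟪a i, a j⟫) :
    ∫ x, expSmoothMax p (fun i => ⟪a i, x⟫) ∂stdGaussian E ≤
      ∫ x, expSmoothMax p (fun i => ⟪b i, x⟫) ∂stdGaussian E := by
  have hmono := monotoneOn_integral_expSmoothMax_inner hp0 hp1 (S := Set.Icc 0 (π / 2))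
    (convex_Icc _ _) (hasDerivAt_rotate a b) (norm_rotate_le a b)
    (fun θ => by simpa [add_comm] using norm_rotate_le b (-a) θ)
    (fun θ _ i => by
      rw [inner_rotate_rotate_neg hab, real_inner_self_eq_norm_sq, real_inner_self_eq_norm_sq,
        hnorm, sub_self, mul_zero])
    (fun θ hθ i j => by
      rw [interior_Icc] at hθ
      have hsin : 0 ≤ sin θ := sin_nonneg_of_nonneg_of_le_pi hθ.1.le (by linarith [hθ.2, pi_pos])
      have hcos : 0 ≤ cos θ :=
        cos_nonneg_of_neg_pi_div_two_le_of_le (by linarith [hθ.1, pi_pos]) hθ.2.le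
      rw [inner_rotate_rotate_neg hab]
      exact mul_nonpos_of_nonneg_of_nonpos (by positivity) (sub_nonpos.2 (hle j i)))
  simpa [rotate] using hmono (Set.left_mem_Icc.2 (by positivity))
    (Set.right_mem_Icc.2 (by positivity)) (by positivity : (0 : ℝ) ≤ π / 2)

variable {F : Type*} [NormedAddCommGroup F] [InnerProductSpace ℝ F] [FiniteDimensional ℝ F]
  [MeasurableSpace F] [BorelSpace F]

/-- **Slepian's comparison inequality**. -/
theorem integral_expSmoothMax_inner_le (hp0 : 0 < p) (hp1 : p ≤ 1) {a : ι → E} {b : ι → F}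
    (hnorm : ∀ i, ‖a i‖ = ‖b i‖) (hle : ∀ i j, ⟪b i, b j⟫ ≤ ⟪a i, a j⟫) :
    ∫ x, expSmoothMax p (fun i => ⟪a i, x⟫) ∂stdGaussian E ≤
      ∫ x, expSmoothMax p (fun i => ⟪b i, x⟫) ∂stdGaussian F := by
  rw [← integral_stdGaussian_fst (E := E) (F := F), ← integral_stdGaussian_snd (E := E) (F := F)]
  simpa using integral_expSmoothMax_inner_le_of_orthogonal hp0 hp1
    (a := fun i => WithLp.toLp 2 (a i, (0 : F))) (b := fun i => WithLp.toLp 2 ((0 : E), b i))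
    (by simp) (by simpa using hnorm) (by simpa using hle)

/-- The factor `exp (ρ ^ 2 / 2)` is the contribution of an independent Gaussian variable of variance
`ρ ^ 2` added to all members of the first family. -/
theorem exp_mul_integral_expSmoothMax_inner_le (hp0 : 0 < p) (hp1 : p ≤ 1) {a : ι → E} {b : ι → F}
    {ρ : ℝ} (hnorm : ∀ i, ‖a i‖ ^ 2 + ρ ^ 2 = ‖b i‖ ^ 2)
    (hle : ∀ i j, ⟪b i, b j⟫ ≤ ⟪a i, a j⟫ + ρ ^ 2) :
    exp (ρ ^ 2 / 2) * ∫ x, expSmoothMax p (fun i => ⟪a i, x⟫) ∂stdGaussian E ≤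
      ∫ x, expSmoothMax p (fun i => ⟪b i, x⟫) ∂stdGaussian F := by
  calc exp (ρ ^ 2 / 2) * ∫ x, expSmoothMax p (fun i => ⟪a i, x⟫) ∂stdGaussian E
      = ∫ z, expSmoothMax p (fun i => ⟪WithLp.toLp 2 (a i, ρ), z⟫)
          ∂stdGaussian (WithLp 2 (E × ℝ)) := by
        rw [mul_comm, ← integral_exp_mul_stdGaussian_real, ← integral_stdGaussian_prod_mul]
        simp_rw [WithLp.prod_inner_apply, expSmoothMax_add_const hp0.ne']
        simp [mul_comm]
    _ ≤ _ := integral_expSmoothMax_inner_le hp0 hp1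
        (fun i => by
          rw [← sq_eq_sq₀ (norm_nonneg _) (norm_nonneg _), WithLp.prod_norm_sq_eq_of_L2]
          simpa using hnorm i)
        (fun i j => by simpa [pow_two] using hle i j)

end Slepian

section Chevet

variable {E : Type*} [NormedAddCommGroup E] [InnerProductSpace ℝ E] [FiniteDimensional ℝ E]
  [MeasurableSpace E] [BorelSpace E]
  {F : Type*} [NormedAddCommGroup F] [InnerProductSpace ℝ F] [FiniteDimensional ℝ F]
  [MeasurableSpace F] [BorelSpace F]
  {H : Type*} [NormedAddCommGroup H] [InnerProductSpace ℝ H] [FiniteDimensional ℝ H]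
  [MeasurableSpace H] [BorelSpace H]

section Finite

variable {ι : Type*} [Fintype ι] {p t : ℝ} {a : ι → E} {v : ι → F} {u : ι → H}

lemma exp_mul_integral_expSmoothMax_le_prod (hp0 : 0 < p) (hp1 : p ≤ 1) (hv : ∀ i, ‖v i‖ = 1)
    (hu : ∀ i, ‖u i‖ = 1) (ha : ∀ i j, ⟪a i, a j⟫ = ⟪v i, v j⟫ * ⟪u i, u j⟫) (t : ℝ) :
    exp (t ^ 2 / 2) * ∫ x, expSmoothMax p (fun i => t * ⟪a i, x⟫) ∂stdGaussian E ≤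
      ∫ z, expSmoothMax p (fun i => t * (⟪v i, z.fst⟫ + ⟪u i, z.snd⟫))
        ∂stdGaussian (WithLp 2 (F × H)) := by
  have ha1 : ∀ i, ‖a i‖ ^ 2 = 1 := fun i => by
    rw [← real_inner_self_eq_norm_sq, ha, real_inner_self_eq_norm_sq, real_inner_self_eq_norm_sq,
      hv, hu]
    norm_num
  have hadd : ∀ i j, ⟪v i, v j⟫ + ⟪u i, u j⟫ ≤ ⟪v i, v j⟫ * ⟪u i, u j⟫ + 1 := fun i j => by
    have hvij : ⟪v i, v j⟫ ≤ 1 := (real_inner_le_norm _ _).trans_eq (by simp [hv])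
    have huij : ⟪u i, u j⟫ ≤ 1 := (real_inner_le_norm _ _).trans_eq (by simp [hu])
    linarith [mul_nonneg (sub_nonneg.2 hvij) (sub_nonneg.2 huij)]
  simpa [real_inner_smul_left, WithLp.prod_inner_apply, mul_add] using
    exp_mul_integral_expSmoothMax_inner_le hp0 hp1 (ρ := t) (a := fun i => t • a i)
      (b := fun i => t • WithLp.toLp 2 (v i, u i))
      (fun i => by
        rw [norm_smul, norm_smul, mul_pow, mul_pow, ha1, WithLp.prod_norm_sq_eq_of_L2]
        simp only [WithLp.toLp_fst, WithLp.toLp_snd, hv, hu, Real.norm_eq_abs, sq_abs]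
        ring)
      (fun i j => by
        simp only [real_inner_smul_left, real_inner_smul_right, ha]
        rw [WithLp.prod_inner_apply]
        linarith [mul_le_mul_of_nonneg_left (hadd i j) (sq_nonneg t)])

lemma integral_expSmoothMax_prod_le (hp0 : 0 < p) (hv : ∀ i, ‖v i‖ = 1) (hu : ∀ i, ‖u i‖ = 1)
    (ht : 0 ≤ t) :
    ∫ z, expSmoothMax p (fun i => t * (⟪v i, z.fst⟫ + ⟪u i, z.snd⟫))
        ∂stdGaussian (WithLp 2 (F × H)) ≤
      (Fintype.card ι : ℝ) ^ p *
        (exp (t * √(finrank ℝ F) + t ^ 2 / 2) * exp (t * √(finrank ℝ H) + t ^ 2 / 2)) := by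
  have hint : Integrable (fun z : WithLp 2 (F × H) => exp (t * ‖z.fst‖) * exp (t * ‖z.snd‖))
      (stdGaussian (WithLp 2 (F × H))) :=
    integrable_stdGaussian_prod_mul (integrable_exp_mul_norm_stdGaussian t)
      (integrable_exp_mul_norm_stdGaussian t)
  calc ∫ z, expSmoothMax p (fun i => t * (⟪v i, z.fst⟫ + ⟪u i, z.snd⟫))
        ∂stdGaussian (WithLp 2 (F × H))
      ≤ ∫ z : WithLp 2 (F × H), (Fintype.card ι : ℝ) ^ p *
          (exp (t * ‖z.fst‖) * exp (t * ‖z.snd‖)) ∂stdGaussian (WithLp 2 (F × H)) := by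
        refine integral_mono_of_nonneg (Eventually.of_forall fun z => expSmoothMax_nonneg _ _)
          (hint.const_mul _) (Eventually.of_forall fun z => ?_)
        dsimp only
        rw [← Real.exp_add, ← mul_add]
        refine expSmoothMax_le hp0 fun i => mul_le_mul_of_nonneg_left (add_le_add ?_ ?_) ht
        · simpa [hv] using real_inner_le_norm (v i) z.fst
        · simpa [hu] using real_inner_le_norm (u i) z.snd
    _ = (Fintype.card ι : ℝ) ^ p * ((∫ x : F, exp (t * ‖x‖) ∂stdGaussian F) *
          ∫ x : H, exp (t * ‖x‖) ∂stdGaussian H) := by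
        rw [integral_const_mul, ← integral_stdGaussian_prod_mul]
    _ ≤ _ := by
        gcongr
        exacts [integral_exp_mul_norm_stdGaussian_le ht, integral_exp_mul_norm_stdGaussian_le ht]

lemma exp_mul_measureReal_exists_lt_inner_le (hp0 : 0 < p) (a : ι → E) (ht : 0 ≤ t) (C : ℝ) :
    exp (t * C) * (stdGaussian E).real {x | ∃ i, C < ⟪a i, x⟫} ≤
      ∫ x, expSmoothMax p (fun i => t * ⟪a i, x⟫) ∂stdGaussian E := by
  have hint : Integrable (fun x => expSmoothMax p fun i => t * ⟪a i, x⟫) (stdGaussian E) := by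
    simpa [real_inner_smul_left] using integrable_expSmoothMax_inner hp0 fun i => t • a i
  refine le_trans ?_ (mul_meas_ge_le_integral_of_nonneg
    (Eventually.of_forall fun x => expSmoothMax_nonneg _ _) hint (exp (t * C)))
  refine mul_le_mul_of_nonneg_left (measureReal_mono ?_) (exp_pos _).le
  rintro x ⟨i, hi⟩
  exact (Real.exp_le_exp.2 (mul_le_mul_of_nonneg_left hi.le ht)).trans
    (exp_le_expSmoothMax hp0 (fun i => t * ⟪a i, x⟫) i)

lemma measureReal_exists_lt_inner_le_card_rpow_mul (hp0 : 0 < p) (hp1 : p ≤ 1)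
    (hv : ∀ i, ‖v i‖ = 1) (hu : ∀ i, ‖u i‖ = 1)
    (ha : ∀ i j, ⟪a i, a j⟫ = ⟪v i, v j⟫ * ⟪u i, u j⟫) (ht : 0 ≤ t) :
    (stdGaussian E).real {x | ∃ i, √(finrank ℝ F) + √(finrank ℝ H) + t < ⟪a i, x⟫} ≤
      (Fintype.card ι : ℝ) ^ p * exp (-t ^ 2 / 2) := by
  set C := √(finrank ℝ F : ℝ) + √(finrank ℝ H : ℝ) + t with hC
  have hexp : exp (t * √(finrank ℝ F) + t ^ 2 / 2) * exp (t * √(finrank ℝ H) + t ^ 2 / 2) =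
      exp (t ^ 2 / 2) * exp (t * C) * exp (-t ^ 2 / 2) := by
    simp_rw [← Real.exp_add, hC]
    ring_nf
  have hbound := calc
    exp (t ^ 2 / 2) * (exp (t * C) * (stdGaussian E).real {x | ∃ i, C < ⟪a i, x⟫})
      ≤ exp (t ^ 2 / 2) * ∫ x, expSmoothMax p (fun i => t * ⟪a i, x⟫) ∂stdGaussian E := by
        gcongr
        exact exp_mul_measureReal_exists_lt_inner_le hp0 a ht C
    _ ≤ _ := exp_mul_integral_expSmoothMax_le_prod hp0 hp1 hv hu ha t
    _ ≤ _ := integral_expSmoothMax_prod_le hp0 hv hu ht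
  rw [hexp] at hbound
  refine le_of_mul_le_mul_left ?_ (by positivity : 0 < exp (t ^ 2 / 2) * exp (t * C))
  linarith

end Finite

lemma measureReal_exists_lt_inner_le {ι : Type*} [Finite ι] {t : ℝ} {a : ι → E} {v : ι → F}
    {u : ι → H} (hv : ∀ i, ‖v i‖ = 1) (hu : ∀ i, ‖u i‖ = 1)
    (ha : ∀ i j, ⟪a i, a j⟫ = ⟪v i, v j⟫ * ⟪u i, u j⟫) (ht : 0 ≤ t) :
    (stdGaussian E).real {x | ∃ i, √(finrank ℝ F) + √(finrank ℝ H) + t < ⟪a i, x⟫} ≤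
      exp (-t ^ 2 / 2) := by
  have := Fintype.ofFinite ι
  rcases isEmpty_or_nonempty ι with _ | _
  · simp [Real.exp_nonneg]
  have hcont : Continuous fun p : ℝ => (Fintype.card ι : ℝ) ^ p * exp (-t ^ 2 / 2) :=
    (Real.continuous_const_rpow (by simp)).mul_const _
  have hlim : Tendsto (fun p : ℝ => (Fintype.card ι : ℝ) ^ p * exp (-t ^ 2 / 2)) (𝓝[>] 0)
      (𝓝 (exp (-t ^ 2 / 2))) := by
    simpa using (hcont.tendsto 0).mono_left nhdsWithin_le_nhds
  refine ge_of_tendsto hlim ?_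
  filter_upwards [Ioc_mem_nhdsGT one_pos] with p hp
  exact measureReal_exists_lt_inner_le_card_rpow_mul hp.1 hp.2 hv hu ha ht

lemma measure_iUnion_le_of_forall_fin {Ω Q : Type*} [MeasurableSpace Ω] {μ : Measure Ω}
    [TopologicalSpace Q] [TopologicalSpace.SeparableSpace Q] {A : Q → Set Ω} {ε : ℝ≥0∞}
    (hA : ∀ ω, IsOpen {q | ω ∈ A q}) (h : ∀ n (q : Fin n → Q), μ (⋃ i, A (q i)) ≤ ε) :
    μ (⋃ q, A q) ≤ ε := by
  rcases isEmpty_or_nonempty Q with _ | _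
  · simp
  set d := TopologicalSpace.denseSeq Q
  have hdense : ⋃ q, A q ⊆ ⋃ n, ⋃ i : Fin n, A (d i) := fun ω hω => by
    obtain ⟨i, hi⟩ := (TopologicalSpace.denseRange_denseSeq Q).exists_mem_open (hA ω)
      (Set.mem_iUnion.1 hω)
    exact Set.mem_iUnion.2 ⟨i + 1, Set.mem_iUnion.2 ⟨⟨i, i.lt_succ_self⟩, hi⟩⟩
  have hmono : Monotone fun n => ⋃ i : Fin n, A (d i) := fun m n hmn =>
    Set.iUnion_subset fun i => Set.subset_iUnion_of_subset (Fin.castLE hmn i) subset_rfl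
  calc μ (⋃ q, A q) ≤ μ (⋃ n, ⋃ i : Fin n, A (d i)) := measure_mono hdense
    _ = ⨆ n, μ (⋃ i : Fin n, A (d i)) := hmono.measure_iUnion
    _ ≤ ε := iSup_le fun n => h n fun i => d i

/-- **Chevet's inequality**, as a tail bound. -/
theorem measure_exists_lt_inner_le {Q : Type*} [TopologicalSpace Q]
    [TopologicalSpace.SeparableSpace Q] {a : Q → E} {v : Q → F} {u : Q → H} (hcont : Continuous a)
    (hv : ∀ q, ‖v q‖ = 1) (hu : ∀ q, ‖u q‖ = 1)
    (ha : ∀ q r, ⟪a q, a r⟫ = ⟪v q, v r⟫ * ⟪u q, u r⟫) {t : ℝ} (ht : 0 ≤ t) :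
    stdGaussian E {x | ∃ q, √(finrank ℝ F) + √(finrank ℝ H) + t < ⟪a q, x⟫} ≤
      ENNReal.ofReal (exp (-t ^ 2 / 2)) := by
  rw [Set.ofPred_exists]
  have hopen : ∀ x, IsOpen {q | √(finrank ℝ F) + √(finrank ℝ H) + t < ⟪a q, x⟫} := fun x =>
    isOpen_lt continuous_const (hcont.inner continuous_const)
  refine measure_iUnion_le_of_forall_fin hopen fun n q => ?_
  rw [← Set.ofPred_exists, ← ofReal_measureReal]
  exact ENNReal.ofReal_le_ofReal (measureReal_exists_lt_inner_le (fun i => hv (q i))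
    (fun i => hu (q i)) (fun i j => ha (q i) (q j)) ht)

end Chevet

section GaussianOperator

variable {H : Type*} [NormedAddCommGroup H] [InnerProductSpace ℝ H] {τ : Type*} [Fintype τ]

/-- The elementary tensor `v ⊗ u`, as the family of vectors `u s • v`. It is the coefficient vector
of the Gaussian variable `⟪v, ∑ s, u s • W s⟫` when `W` is a standard Gaussian family in `H`. -/
noncomputable def elementaryTensor (v : H) (u : EuclideanSpace ℝ τ) : PiLp 2 fun _ : τ => H :=
  WithLp.toLp 2 fun s => u s • v

lemma inner_elementaryTensor (v : H) (u : EuclideanSpace ℝ τ) (W : PiLp 2 fun _ : τ => H) :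
    ⟪elementaryTensor v u, W⟫ = ⟪v, ∑ s, u s • W s⟫ := by
  simp [elementaryTensor, PiLp.inner_apply, inner_sum, real_inner_smul_left, real_inner_smul_right]

lemma inner_elementaryTensor_elementaryTensor (v v' : H) (u u' : EuclideanSpace ℝ τ) :
    ⟪elementaryTensor v u, elementaryTensor v' u'⟫ = ⟪v, v'⟫ * ⟪u, u'⟫ := by
  simp only [elementaryTensor, PiLp.inner_apply, real_inner_smul_left, real_inner_smul_right,
    Finset.mul_sum]
  refine Finset.sum_congr rfl fun s _ => ?_
  simp
  ring

lemma exists_sphere_lt_inner {V : Type*} [NormedAddCommGroup V] [NormedSpace ℝ V] {L : V →ₗ[ℝ] H}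
    {C : ℝ} (hC : 0 ≤ C) {u : V} (hu : C * ‖u‖ < ‖L u‖) :
    ∃ q : Metric.sphere (0 : H) 1 × Metric.sphere (0 : V) 1, C < ⟪(q.1 : H), L q.2⟫ := by
  have hLu : L u ≠ 0 := norm_pos_iff.1 ((by positivity : 0 ≤ C * ‖u‖).trans_lt hu)
  have hu0 : u ≠ 0 := fun h => hLu (by rw [h, map_zero])
  refine ⟨(⟨‖L u‖⁻¹ • L u, by simp [norm_smul, hLu]⟩, ⟨‖u‖⁻¹ • u, by simp [norm_smul, hu0]⟩), ?_⟩
  have hpos : 0 < ‖u‖ := norm_pos_iff.2 hu0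
  have hinner : ⟪‖L u‖⁻¹ • L u, L (‖u‖⁻¹ • u)⟫ = ‖L u‖ / ‖u‖ := by
    rw [map_smul, real_inner_smul_left, real_inner_smul_right, real_inner_self_eq_norm_sq]
    have := norm_pos_iff.2 hLu
    field_simp
  rw [hinner, lt_div_iff₀ hpos]
  exact hu

variable [FiniteDimensional ℝ H] [MeasurableSpace H] [BorelSpace H]

/-- The **Davidson–Szarek bound** for the operator `u ↦ ∑ s, u s • W s` restricted to a subspace. -/
theorem measure_exists_lt_norm_sum_smul_le (K : Submodule ℝ (EuclideanSpace ℝ τ)) {t : ℝ}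
    (ht : 0 ≤ t) :
    stdGaussian (PiLp 2 fun _ : τ => H)
      {W | ∃ u ∈ K, (√(finrank ℝ H) + √(finrank ℝ K) + t) * ‖u‖ < ‖∑ s, u s • W s‖} ≤
      ENNReal.ofReal (exp (-t ^ 2 / 2)) := by
  let a : Metric.sphere (0 : H) 1 × Metric.sphere (0 : K) 1 → PiLp 2 fun _ : τ => H :=
    fun q => elementaryTensor q.1 q.2
  have hcont : Continuous a := by unfold a elementaryTensor; fun_prop
  refine (measure_mono ?_).trans (measure_exists_lt_inner_le (a := a) (v := fun q => (q.1 : H))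
    (u := fun q => (q.2 : K)) hcont (fun q => by simp) (fun q => by simp)
    (fun q r => inner_elementaryTensor_elementaryTensor _ _ _ _) ht)
  rintro W ⟨u, hu, hlt⟩
  let L : K →ₗ[ℝ] H := Fintype.linearCombination ℝ W.ofLp ∘ₗ
    (WithLp.linearEquiv 2 ℝ (τ → ℝ)).toLinearMap ∘ₗ K.subtype
  have hL : ∀ u : K, L u = ∑ s, u.1 s • W s := fun u => by
    simp [L, Fintype.linearCombination_apply]
  obtain ⟨q, hq⟩ := exists_sphere_lt_inner (L := L) (u := ⟨u, hu⟩)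
    (C := √(finrank ℝ H) + √(finrank ℝ K) + t) (by positivity) (by rw [hL]; exact hlt)
  exact ⟨q, by rwa [inner_elementaryTensor, ← hL]⟩

end GaussianOperator

section LeastSquares

variable {ι κ : Type*} [Fintype ι] [Fintype κ] {nx N : ℕ}

section InvQuadForm

variable [DecidableEq ι] {M : Matrix ι ι ℝ}

lemma inner_eigenvectorBasis_mulVec (hM : M.IsHermitian) (k : ι) (u : EuclideanSpace ℝ ι) :
    ⟪hM.eigenvectorBasis k, WithLp.toLp 2 (M *ᵥ u.ofLp)⟫ =
      hM.eigenvalues k * ⟪hM.eigenvectorBasis k, u⟫ := by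
  calc ⟪hM.eigenvectorBasis k, WithLp.toLp 2 (M *ᵥ u.ofLp)⟫
      = ⟪WithLp.toLp 2 (M *ᵥ (hM.eigenvectorBasis k).ofLp), u⟫ :=
        (Matrix.isSymmetric_toEuclideanLin_iff.2 hM _ u).symm
    _ = _ := by rw [hM.mulVec_eigenvectorBasis, WithLp.toLp_smul, real_inner_smul_left]

lemma dotProduct_mulVec_eq_sum_eigenvalues (hM : M.IsHermitian) (u : EuclideanSpace ℝ ι) :
    u.ofLp ⬝ᵥ M *ᵥ u.ofLp = ∑ k, hM.eigenvalues k * ⟪hM.eigenvectorBasis k, u⟫ ^ 2 := by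
  calc u.ofLp ⬝ᵥ M *ᵥ u.ofLp = ⟪u, WithLp.toLp 2 (M *ᵥ u.ofLp)⟫ := by
        simp [EuclideanSpace.inner_eq_star_dotProduct, dotProduct_comm]
    _ = _ := by
        rw [← hM.eigenvectorBasis.sum_inner_mul_inner]
        refine Finset.sum_congr rfl fun k _ => ?_
        rw [inner_eigenvectorBasis_mulVec hM, real_inner_comm]
        ring

variable (hM : M.PosSemidef)

lemma invQuadForm_mulVec (u : EuclideanSpace ℝ ι) :
    invQuadForm hM (WithLp.toLp 2 (M *ᵥ u.ofLp)) = ENNReal.ofReal (u.ofLp ⬝ᵥ M *ᵥ u.ofLp) := by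
  rw [dotProduct_mulVec_eq_sum_eigenvalues hM.isHermitian, ENNReal.ofReal_sum_of_nonneg fun k _ =>
    mul_nonneg (hM.eigenvalues_nonneg k) (sq_nonneg _)]
  refine Finset.sum_congr rfl fun k _ => ?_
  rw [inner_eigenvectorBasis_mulVec]
  rcases (hM.eigenvalues_nonneg k).eq_or_lt with hk | hk
  · simp [← hk]
  · rw [← ENNReal.ofReal_inv_of_pos hk, ← ENNReal.ofReal_mul (by positivity)]
    congr 1
    field_simp

lemma invQuadForm_eq_top_or_exists_mulVec_eq (v : EuclideanSpace ℝ ι) :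
    invQuadForm hM v = ⊤ ∨ ∃ u : EuclideanSpace ℝ ι, v = WithLp.toLp 2 (M *ᵥ u.ofLp) := by
  set q := hM.isHermitian.eigenvectorBasis
  set l := hM.isHermitian.eigenvalues with hl
  by_cases hker : ∀ k, l k = 0 → ⟪q k, v⟫ = 0
  · refine .inr ⟨∑ k, ((l k)⁻¹ * ⟪q k, v⟫) • q k, q.repr.injective (PiLp.ext fun k => ?_)⟩
    rw [q.repr_apply_apply, q.repr_apply_apply, inner_eigenvectorBasis_mulVec, ← hl,
      q.orthonormal.inner_right_fintype]
    rcases eq_or_ne (l k) 0 with hk | hk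
    · simp [hk, hker k hk]
    · field_simp
  · push Not at hker
    obtain ⟨k, hk, hkv⟩ := hker
    refine .inl (ENNReal.sum_eq_top.2 ⟨k, Finset.mem_univ k, ?_⟩)
    rw [← hl, hk, ENNReal.ofReal_zero, ENNReal.inv_zero, ENNReal.top_mul]
    simpa using hkv

lemma leScaledInv_of_norm_mulVec_le {D : Matrix κ ι ℝ} {c : ℝ} (hc : 0 < c)
    (h : ∀ u, ‖WithLp.toLp 2 (D *ᵥ (M *ᵥ u))‖ ^ 2 ≤ c * (u ⬝ᵥ M *ᵥ u)) :
    LeScaledInv (Dᵀ * D) c hM := by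
  intro v
  obtain htop | ⟨u, rfl⟩ := invQuadForm_eq_top_or_exists_mulVec_eq hM v
  · rw [htop, ENNReal.mul_top (by simpa using hc)]
    exact le_top
  · rw [invQuadForm_mulVec, ← ENNReal.ofReal_mul hc.le]
    refine ENNReal.ofReal_le_ofReal (le_of_eq_of_le ?_ (h u.ofLp))
    rw [← Matrix.mulVec_mulVec, Matrix.dotProduct_mulVec, Matrix.vecMul_transpose,
      EuclideanSpace.real_norm_sq_eq]
    simp [dotProduct, pow_two]

end InvQuadForm

lemma gram_mulVec (y : Fin N → ι → ℝ) (u : ι → ℝ) :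
    gram y *ᵥ u = ∑ t, (y t ⬝ᵥ u) • y t := by
  simp [gram, Matrix.sum_mulVec, Matrix.vecMulVec_mulVec]

lemma dotProduct_gram_mulVec (y : Fin N → ι → ℝ) (u : ι → ℝ) :
    u ⬝ᵥ gram y *ᵥ u = ‖WithLp.toLp 2 fun t => y t ⬝ᵥ u‖ ^ 2 := by
  rw [gram_mulVec, dotProduct_sum, EuclideanSpace.real_norm_sq_eq]
  refine Finset.sum_congr rfl fun t _ => ?_
  rw [dotProduct_smul, dotProduct_comm u, smul_eq_mul]
  ring

/-- The noise `w` is bounded by `C` against the regressors `y`, normalized by the data matrix: `C`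
bounds the operator `(⟪y t, u⟫)ₜ ↦ ∑ t, ⟪y t, u⟫ • w t` on the column space of the regressors. -/
def SelfNormalizedBound {τ H : Type*} [Fintype τ] [NormedAddCommGroup H] [NormedSpace ℝ H]
    (y : τ → ι → ℝ) (w : τ → H) (C : ℝ) : Prop :=
  ∀ u, ‖∑ t, (y t ⬝ᵥ u) • w t‖ ≤ C * ‖WithLp.toLp 2 fun t => y t ⬝ᵥ u‖

namespace IsOLS

variable {y : Fin N → ι → ℝ} {z w : Fin N → EuclideanSpace ℝ (Fin nx)}
  {Θ Θ' : Matrix (Fin nx) ι ℝ}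

lemma sum_inner_residual_mulVec_eq_zero (h : IsOLS y z Θ) (D : Matrix (Fin nx) ι ℝ) :
    ∑ t, ⟪z t - WithLp.toLp 2 (Θ *ᵥ y t), WithLp.toLp 2 (D *ᵥ y t)⟫ = 0 := by
  set r : Fin N → EuclideanSpace ℝ (Fin nx) := fun t => z t - WithLp.toLp 2 (Θ *ᵥ y t) with hr
  have hline : ∀ (s : ℝ) t, z t - WithLp.toLp 2 ((Θ + s • D) *ᵥ y t) =
      r t - s • WithLp.toLp 2 (D *ᵥ y t) := fun s t => by
    simp only [hr, Matrix.add_mulVec, Matrix.smul_mulVec, WithLp.toLp_add, WithLp.toLp_smul]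
    abel
  have hderiv : HasLineDerivAt ℝ
      (fun Θ' : Matrix (Fin nx) ι ℝ => ∑ t, ‖z t - WithLp.toLp 2 (Θ' *ᵥ y t)‖ ^ 2)
      (∑ t, 2 * ⟪r t, -WithLp.toLp 2 (D *ᵥ y t)⟫) Θ D := by
    simp only [HasLineDerivAt, hline]
    refine HasDerivAt.fun_sum fun t _ => ?_
    simpa using (((hasDerivAt_id (0 : ℝ)).smul_const (WithLp.toLp 2 (D *ᵥ y t))).const_sub
      (r t)).norm_sq
  have hzero := IsMinOn.hasLineDerivAt_eq_zero h hderiv (by simp)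
  simpa [inner_neg_right, ← Finset.mul_sum] using hzero

theorem sum_dotProduct_smul_residual_eq_zero (h : IsOLS y z Θ) (u : ι → ℝ) :
    ∑ t, (y t ⬝ᵥ u) • (z t - WithLp.toLp 2 (Θ *ᵥ y t)) = 0 := by
  refine ext_inner_right ℝ fun S => ?_
  have hrank : ∀ t, WithLp.toLp 2 (Matrix.vecMulVec S.ofLp u *ᵥ y t) = (y t ⬝ᵥ u) • S :=
    fun t => by rw [Matrix.vecMulVec_mulVec, dotProduct_comm u]; simp
  simpa [sum_inner, hrank, real_inner_smul_left, real_inner_smul_right] using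
    h.sum_inner_residual_mulVec_eq_zero (Matrix.vecMulVec S.ofLp u)

lemma sub_mulVec_gram_mulVec (h : IsOLS y z Θ)
    (hz : ∀ t, z t = WithLp.toLp 2 (Θ' *ᵥ y t) + w t) (u : ι → ℝ) :
    WithLp.toLp 2 ((Θ - Θ') *ᵥ (gram y *ᵥ u)) = ∑ t, (y t ⬝ᵥ u) • w t := by
  rw [← sub_eq_zero, ← neg_eq_zero, ← h.sum_dotProduct_smul_residual_eq_zero u, gram_mulVec,
    Matrix.mulVec_sum, WithLp.toLp_sum, ← Finset.sum_sub_distrib, ← Finset.sum_neg_distrib]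
  refine Finset.sum_congr rfl fun t _ => ?_
  rw [hz, Matrix.mulVec_smul, Matrix.sub_mulVec, WithLp.toLp_smul, WithLp.toLp_sub]
  module

lemma leScaledInv [DecidableEq ι] (h : IsOLS y z Θ)
    (hz : ∀ t, z t = WithLp.toLp 2 (Θ' *ᵥ y t) + w t) {C : ℝ} (hC : 0 < C)
    (hw : SelfNormalizedBound y w C) :
    LeScaledInv ((Θ - Θ')ᵀ * (Θ - Θ')) (C ^ 2) (gram_posSemidef y) := by
  refine leScaledInv_of_norm_mulVec_le _ (by positivity) fun u => ?_
  rw [h.sub_mulVec_gram_mulVec hz, dotProduct_gram_mulVec, ← mul_pow]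
  exact pow_le_pow_left₀ (norm_nonneg _) (hw u) 2

end IsOLS

end LeastSquares

section IndependentRegressors

variable {Ω 𝒴 𝒲 : Type*} [MeasurableSpace Ω] [MeasurableSpace 𝒴] [MeasurableSpace 𝒲]
  {P : Measure Ω}

lemma hasLaw_prodMk_pi {τ : Type*} [Fintype τ] {μ : τ → Measure 𝒴} {ν : τ → Measure 𝒲}
    [∀ t, SigmaFinite (μ t)] [∀ t, SigmaFinite (ν t)] [IsFiniteMeasure P] {y : τ → Ω → 𝒴}
    {w : τ → Ω → 𝒲} (hindep : iIndepFun (fun t ω => (y t ω, w t ω)) P)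
    (hyw : ∀ t, IndepFun (y t) (w t) P) (hy : ∀ t, HasLaw (y t) (μ t) P)
    (hw : ∀ t, HasLaw (w t) (ν t) P) :
    HasLaw (fun ω => ((y · ω), (w · ω))) ((Measure.pi μ).prod (Measure.pi ν)) P :=
  (measurePreserving_arrowProdEquivProdArrow 𝒴 𝒲 τ μ ν).comp_hasLaw
    (hindep.hasLaw_pi fun t => (hyw t).hasLaw_prod (hy t) (hw t))

lemma measure_le_of_hasLaw_prod {μ : Measure 𝒴} {ν : Measure 𝒲} [IsProbabilityMeasure μ]
    [SFinite ν] {X : Ω → 𝒴 × 𝒲} (hX : HasLaw X (μ.prod ν) P) {p : 𝒴 × 𝒲 → Prop}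
    (hp : MeasurableSet {z | p z}) {ε : ℝ≥0∞} (h : ∀ y, ν {w | p (y, w)} ≤ ε) :
    P {ω | p (X ω)} ≤ ε := by
  calc P {ω | p (X ω)} = ∫⁻ y, ν {w | p (y, w)} ∂μ := by
        rw [hX.measure_eq hp, Measure.prod_apply hp]
        rfl
    _ ≤ ∫⁻ _, ε ∂μ := lintegral_mono h
    _ = ε := by simp

end IndependentRegressors

section GaussianNoise

variable {τ ι : Type*} [Fintype τ] [Fintype ι]

section SelfNormalizedBound

variable {H : Type*} [NormedAddCommGroup H] [NormedSpace ℝ H]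

lemma isClosed_selfNormalizedBound (C : ℝ) :
    IsClosed {p : (τ → ι → ℝ) × (τ → H) | SelfNormalizedBound p.1 p.2 C} := by
  simp only [SelfNormalizedBound, Set.ofPred_forall, dotProduct]
  exact isClosed_iInter fun u => isClosed_le (by fun_prop) (by fun_prop)

lemma SelfNormalizedBound.of_inv_smul {y : τ → ι → ℝ} {w : τ → H} {C σ : ℝ} (hσ : 0 < σ)
    (h : SelfNormalizedBound y (fun t => σ⁻¹ • w t) C) : SelfNormalizedBound y w (σ * C) := by
  intro u
  have hu := h u
  simp_rw [smul_comm _ σ⁻¹, ← Finset.smul_sum] at hu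
  rw [norm_smul, norm_inv, Real.norm_of_nonneg hσ.le, inv_mul_le_iff₀ hσ] at hu
  rwa [mul_assoc]

end SelfNormalizedBound

variable {H : Type*} [NormedAddCommGroup H] [InnerProductSpace ℝ H] [FiniteDimensional ℝ H]
  [MeasurableSpace H] [BorelSpace H] {s : ℝ}

lemma pi_stdGaussian_not_selfNormalizedBound_le (hs : 0 ≤ s) (y : τ → ι → ℝ) :
    (Measure.pi fun _ : τ => stdGaussian H)
      {w | ¬ SelfNormalizedBound y w (√(finrank ℝ H) + √(Fintype.card ι) + s)} ≤
      ENNReal.ofReal (exp (-s ^ 2 / 2)) := by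
  let Y : (ι → ℝ) →ₗ[ℝ] EuclideanSpace ℝ τ :=
    (WithLp.linearEquiv 2 ℝ (τ → ℝ)).symm.toLinearMap ∘ₗ Matrix.mulVecLin (Matrix.of y)
  have hrank : (finrank ℝ (LinearMap.range Y) : ℝ) ≤ Fintype.card ι :=
    mod_cast (LinearMap.finrank_range_le Y).trans_eq (by simp)
  calc (Measure.pi fun _ : τ => stdGaussian H)
        {w | ¬ SelfNormalizedBound y w (√(finrank ℝ H) + √(Fintype.card ι) + s)}
      ≤ (Measure.pi fun _ : τ => stdGaussian H) (WithLp.toLp 2 ⁻¹' {W | ∃ v ∈ LinearMap.range Y,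
          (√(finrank ℝ H) + √(finrank ℝ (LinearMap.range Y)) + s) * ‖v‖ < ‖∑ t, v t • W t‖}) := by
        refine measure_mono fun w hw => ?_
        simp only [SelfNormalizedBound, not_forall, not_le, Set.mem_ofPred_eq] at hw
        obtain ⟨u, hu⟩ := hw
        refine ⟨Y u, ⟨u, rfl⟩, lt_of_le_of_lt ?_ hu⟩
        change _ ≤ _ * ‖Y u‖
        gcongr
    _ ≤ stdGaussian (PiLp 2 fun _ : τ => H) _ := by
        rw [← map_toLp_pi_stdGaussian]
        exact Measure.le_map_apply (by fun_prop) _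
    _ ≤ _ := measure_exists_lt_norm_sum_smul_le _ hs

variable {Ω : Type*} [MeasurableSpace Ω] {P : Measure Ω} [IsProbabilityMeasure P]
  {y : τ → Ω → ι → ℝ}

lemma measure_not_selfNormalizedBound_le_of_stdGaussian (hs : 0 ≤ s) {w : τ → Ω → H}
    (hindep : iIndepFun (fun t ω => (y t ω, w t ω)) P) (hyw : ∀ t, IndepFun (y t) (w t) P)
    (hy : ∀ t, AEMeasurable (y t) P) (hw : ∀ t, HasLaw (w t) (stdGaussian H) P) :
    P {ω | ¬ SelfNormalizedBound (y · ω) (w · ω) (√(finrank ℝ H) + √(Fintype.card ι) + s)} ≤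
      ENNReal.ofReal (exp (-s ^ 2 / 2)) := by
  have hprob : ∀ t, IsProbabilityMeasure (P.map (y t)) := fun t =>
    Measure.isProbabilityMeasure_map (hy t)
  exact measure_le_of_hasLaw_prod (hasLaw_prodMk_pi hindep hyw (fun t => ⟨hy t, rfl⟩) hw)
    (p := fun z => ¬ SelfNormalizedBound z.1 z.2 _)
    (isClosed_selfNormalizedBound _).measurableSet.compl
    (pi_stdGaussian_not_selfNormalizedBound_le hs)

variable {κ : Type*} [Fintype κ] [DecidableEq κ] {σ : ℝ} {w : τ → Ω → EuclideanSpace ℝ κ}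

theorem measure_not_selfNormalizedBound_le (hs : 0 ≤ s) (hσ : 0 < σ)
    (hindep : iIndepFun (fun t ω => (y t ω, w t ω)) P) (hyw : ∀ t, IndepFun (y t) (w t) P)
    (hy : ∀ t, AEMeasurable (y t) P)
    (hw : ∀ t, HasLaw (w t) (multivariateGaussian 0 (σ ^ 2 • (1 : Matrix κ κ ℝ))) P) :
    P {ω | ¬ SelfNormalizedBound (y · ω) (w · ω)
        (σ * (√(Fintype.card κ) + √(Fintype.card ι) + s))} ≤ ENNReal.ofReal (exp (-s ^ 2 / 2)) := by
  have hstd : HasLaw (σ⁻¹ • ·) (stdGaussian (EuclideanSpace ℝ κ))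
      (multivariateGaussian 0 (σ ^ 2 • (1 : Matrix κ κ ℝ))) :=
    ⟨by fun_prop, map_inv_smul_multivariateGaussian hσ.ne'⟩
  refine (measure_mono ?_).trans (measure_not_selfNormalizedBound_le_of_stdGaussian (s := s) hs
    (w := fun t ω => σ⁻¹ • w t ω)
    (hindep.comp (fun _ q => (q.1, σ⁻¹ • q.2)) fun _ => by fun_prop)
    (fun t => (hyw t).comp measurable_id (measurable_const_smul σ⁻¹)) hy
    (fun t => hstd.comp (hw t)))
  intro ω hω hbound
  rw [finrank_euclideanSpace] at hbound
  exact hω (hbound.of_inv_smul hσ)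

end GaussianNoise

section Experiments

variable {nx nu : ℕ}

lemma step_input_zero (A : Matrix (Fin nx) (Fin nx) ℝ) (B₀ : Matrix (Fin nx) (Fin nu) ℝ)
    (B : Fin nu → Matrix (Fin nx) (Fin nx) ℝ) (x w : EuclideanSpace ℝ (Fin nx)) :
    step A B₀ B x (input 0) w = WithLp.toLp 2 (A *ᵥ x.ofLp) + w := by
  simp [step, input]

lemma appendCol_mulVec_affineRegressor (B : Matrix (Fin nx) (Fin nx) ℝ) (b : Fin nx → ℝ)
    (x : EuclideanSpace ℝ (Fin nx)) : appendCol B b *ᵥ affineRegressor x = B *ᵥ x.ofLp + b := by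
  rw [appendCol, affineRegressor, Matrix.fromCols_mulVec_sumElim]
  congr 1
  ext j
  simp [Matrix.mulVec, dotProduct]

lemma step_input_succ (A : Matrix (Fin nx) (Fin nx) ℝ) (B₀ : Matrix (Fin nx) (Fin nu) ℝ)
    (B : Fin nu → Matrix (Fin nx) (Fin nx) ℝ) (i : Fin nu) (x w : EuclideanSpace ℝ (Fin nx)) :
    step A B₀ B x (input i.succ) w =
      WithLp.toLp 2 (appendCol (B i) (B₀.col i) *ᵥ affineRegressor x) + w := by
  have hsum : ∑ j, (Pi.single i (1 : ℝ) : Fin nu → ℝ) j • ((B j - A) *ᵥ x.ofLp) =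
      (B i - A) *ᵥ x.ofLp := by
    simp [Pi.single_apply, ite_smul]
  rw [appendCol_mulVec_affineRegressor]
  simp only [step, input, Fin.cases_succ, PiLp.ofLp_single, Matrix.mulVec_single_one]
  rw [hsum, Matrix.sub_mulVec]
  congr 2
  abel

lemma appendCol_sub (B B' : Matrix (Fin nx) (Fin nx) ℝ) (b b' : Fin nx → ℝ) :
    appendCol (B - B') (b - b') = appendCol B b - appendCol B' b' := by
  ext _ (_ | _) <;> simp [appendCol]

lemma measurable_affineRegressor : Measurable (affineRegressor (nx := nx)) :=
  measurable_pi_iff.2 <| by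
    rintro (_ | _) <;> simp only [affineRegressor, Sum.elim_inl, Sum.elim_inr] <;> fun_prop

lemma exp_neg_sq_sqrt_two_mul_log_inv {ε : ℝ} (hε0 : 0 < ε) (hε1 : ε ≤ 1) :
    exp (-√(2 * log ε⁻¹) ^ 2 / 2) = ε := by
  have hlog : 0 ≤ log ε⁻¹ := log_nonneg ((one_le_inv₀ hε0).2 hε1)
  rw [sq_sqrt (by positivity), log_inv, show -(2 * -log ε) / 2 = log ε by ring, exp_log hε0]

variable {Ω : Type*} [MeasurableSpace Ω] {P : Measure Ω} [IsProbabilityMeasure P]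

theorem measure_not_leScaledInv_le {ι : Type*} [Fintype ι] [DecidableEq ι] {N : ℕ} {σ ε : ℝ}
    (hσ : 0 < σ) (hε : ε ∈ Set.Ioo (0 : ℝ) 1) {y : Fin N → Ω → ι → ℝ}
    {w z : Fin N → Ω → EuclideanSpace ℝ (Fin nx)} {Θ' : Matrix (Fin nx) ι ℝ}
    {Θ : Ω → Matrix (Fin nx) ι ℝ} (hindep : iIndepFun (fun t ω => (y t ω, w t ω)) P)
    (hyw : ∀ t, IndepFun (y t) (w t) P) (hy : ∀ t, AEMeasurable (y t) P)
    (hw : ∀ t, HasLaw (w t)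
      (multivariateGaussian 0 (σ ^ 2 • (1 : Matrix (Fin nx) (Fin nx) ℝ))) P)
    (hz : ∀ t ω, z t ω = WithLp.toLp 2 (Θ' *ᵥ y t ω) + w t ω)
    (hΘ : ∀ ω, IsOLS (y · ω) (z · ω) (Θ ω)) :
    P {ω | ¬ LeScaledInv ((Θ ω - Θ')ᵀ * (Θ ω - Θ'))
        (σ ^ 2 * (√nx + √(Fintype.card ι) + √(2 * log ε⁻¹)) ^ 2) (gram_posSemidef (y · ω))} ≤
      ENNReal.ofReal ε := by
  have hlog : 0 < log ε⁻¹ := log_pos ((one_lt_inv₀ hε.1).2 hε.2)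
  refine (measure_mono ?_).trans ((measure_not_selfNormalizedBound_le (sqrt_nonneg (2 * log ε⁻¹))
    hσ hindep hyw hy hw).trans_eq (by rw [exp_neg_sq_sqrt_two_mul_log_inv hε.1 hε.2.le]))
  intro ω hω hbound
  rw [Fintype.card_fin] at hbound
  refine hω ?_
  rw [← mul_pow]
  exact (hΘ ω).leScaledInv (fun t => hz t ω) (by positivity) hbound

section Inputs

variable {A : Matrix (Fin nx) (Fin nx) ℝ} {B₀ : Matrix (Fin nx) (Fin nu) ℝ}
  {B : Fin nu → Matrix (Fin nx) (Fin nx) ℝ} {N : ℕ} {σ ε : ℝ}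
  {x w xplus : Fin N → Ω → EuclideanSpace ℝ (Fin nx)}

lemma measure_not_leScaledInv_input_zero_le (hσ : 0 < σ) (hε : ε ∈ Set.Ioo (0 : ℝ) 1)
    (hindep : iIndepFun (fun t ω => (x t ω, w t ω)) P) (hxw : ∀ t, IndepFun (x t) (w t) P)
    (hx : ∀ t, AEMeasurable (x t) P)
    (hw : ∀ t, HasLaw (w t)
      (multivariateGaussian 0 (σ ^ 2 • (1 : Matrix (Fin nx) (Fin nx) ℝ))) P)
    (hxplus : ∀ t ω, xplus t ω = step A B₀ B (x t ω) (input 0) (w t ω))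
    {Ahat : Ω → Matrix (Fin nx) (Fin nx) ℝ}
    (hAhat : ∀ ω, IsOLS (fun t => (x t ω).ofLp) (xplus · ω) (Ahat ω)) :
    P {ω | ¬ LeScaledInv ((Ahat ω - A)ᵀ * (Ahat ω - A))
        (σ ^ 2 * (2 * √nx + √(2 * log ε⁻¹)) ^ 2)
        (gram_posSemidef fun t => (x t ω).ofLp)} ≤ ENNReal.ofReal ε := by
  have h := measure_not_leScaledInv_le (y := fun t ω => (x t ω).ofLp) hσ hε
    (hindep.comp (fun _ q => (q.1.ofLp, q.2)) fun _ => by fun_prop)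
    (fun t => (hxw t).comp (by fun_prop) measurable_id)
    (fun t => Measurable.comp_aemeasurable (by fun_prop) (hx t)) hw
    (fun t ω => (hxplus t ω).trans (step_input_zero ..)) hAhat
  rwa [Fintype.card_fin, ← two_mul] at h

lemma measure_not_leScaledInv_input_succ_le (hσ : 0 < σ) (hε : ε ∈ Set.Ioo (0 : ℝ) 1)
    (hindep : iIndepFun (fun t ω => (x t ω, w t ω)) P) (hxw : ∀ t, IndepFun (x t) (w t) P)
    (hx : ∀ t, AEMeasurable (x t) P)
    (hw : ∀ t, HasLaw (w t)
      (multivariateGaussian 0 (σ ^ 2 • (1 : Matrix (Fin nx) (Fin nx) ℝ))) P)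
    {i : Fin nu} (hxplus : ∀ t ω, xplus t ω = step A B₀ B (x t ω) (input i.succ) (w t ω))
    {Bhat : Ω → Matrix (Fin nx) (Fin nx) ℝ} {B₀hat : Ω → Matrix (Fin nx) (Fin nu) ℝ}
    (hBhat : ∀ ω, IsOLS (fun t => affineRegressor (x t ω)) (xplus · ω)
      (appendCol (Bhat ω) ((B₀hat ω).col i))) :
    P {ω | ¬ LeScaledInv ((appendCol (Bhat ω - B i) ((B₀hat ω - B₀).col i))ᵀ *
          appendCol (Bhat ω - B i) ((B₀hat ω - B₀).col i))
        (σ ^ 2 * (√((nx : ℝ) + 1) + √nx + √(2 * log ε⁻¹)) ^ 2)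
        (gram_posSemidef fun t => affineRegressor (x t ω))} ≤ ENNReal.ofReal ε := by
  have h := measure_not_leScaledInv_le (y := fun t ω => affineRegressor (x t ω)) hσ hε
    (hindep.comp (fun _ q => (affineRegressor q.1, q.2)) fun _ =>
      (measurable_affineRegressor.comp measurable_fst).prodMk measurable_snd)
    (fun t => (hxw t).comp measurable_affineRegressor measurable_id)
    (fun t => measurable_affineRegressor.comp_aemeasurable (hx t)) hw
    (fun t ω => (hxplus t ω).trans (step_input_succ ..)) hBhat
  simp_rw [← appendCol_sub] at h
  rwa [Fintype.card_sum, Fintype.card_fin, Fintype.card_unit, Nat.cast_add, Nat.cast_one,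
    add_comm √(nx : ℝ)] at h

end Inputs

lemma exists_measurableSet_forall_mem {ι : Type*} [Fintype ι] {p : ι → Ω → Prop} {ε : ι → ℝ}
    {δ : ℝ} (hδ : ∑ i, ε i ≤ δ) (hε : ∀ i, 0 ≤ ε i)
    (hp : ∀ i, P {ω | ¬ p i ω} ≤ ENNReal.ofReal (ε i)) :
    ∃ E, MeasurableSet E ∧ ENNReal.ofReal (1 - δ) ≤ P E ∧ ∀ ω ∈ E, ∀ i, p i ω := by
  set F := toMeasurable P (⋃ i, {ω | ¬ p i ω})
  have hPF : P F ≤ ENNReal.ofReal δ := calc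
    P F = P (⋃ i, {ω | ¬ p i ω}) := measure_toMeasurable _
    _ ≤ ∑ i, P {ω | ¬ p i ω} := measure_iUnion_fintype_le P _
    _ ≤ ∑ i, ENNReal.ofReal (ε i) := Finset.sum_le_sum fun i _ => hp i
    _ = ENNReal.ofReal (∑ i, ε i) := (ENNReal.ofReal_sum_of_nonneg fun i _ => hε i).symm
    _ ≤ ENNReal.ofReal δ := ENNReal.ofReal_le_ofReal hδ
  refine ⟨Fᶜ, (measurableSet_toMeasurable _ _).compl, ?_, fun ω hω i => ?_⟩
  · rw [prob_compl_eq_one_sub (measurableSet_toMeasurable _ _),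
      ENNReal.ofReal_sub _ ((Finset.sum_nonneg fun i _ => hε i).trans hδ), ENNReal.ofReal_one]
    gcongr
  · by_contra hpi
    exact hω (subset_toMeasurable _ _ (Set.mem_iUnion.2 ⟨i, hpi⟩))

lemma half_add_sum_div_two_mul_le {δ : ℝ} (hδ : 0 ≤ δ) (n : ℕ) :
    δ / 2 + ∑ _i : Fin n, δ / (2 * n) ≤ δ := by
  rcases n.eq_zero_or_pos with rfl | hn
  · simpa using half_le_self hδ
  · have : (n : ℝ) ≠ 0 := by positivity
    refine le_of_eq ?_
    simp only [Finset.sum_const, Finset.card_univ, Fintype.card_fin, nsmul_eq_mul]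
    field_simp
    norm_num

lemma exists_measurableSet_and_forall_mem {p : Ω → Prop} {q : Fin nu → Ω → Prop} {δ : ℝ}
    (hδ : 0 ≤ δ) (hp : P {ω | ¬ p ω} ≤ ENNReal.ofReal (δ / 2))
    (hq : ∀ i, P {ω | ¬ q i ω} ≤ ENNReal.ofReal (δ / (2 * nu))) :
    ∃ E, MeasurableSet E ∧ ENNReal.ofReal (1 - δ) ≤ P E ∧ ∀ ω ∈ E, p ω ∧ ∀ i, q i ω := by
  obtain ⟨E, hE, hPE, hEpq⟩ := exists_measurableSet_forall_mem (P := P)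
    (p := (Fin.cons p q : Fin (nu + 1) → Ω → Prop)) (ε := Fin.cons (δ / 2) fun _ => δ / (2 * nu))
    (by simpa [Fin.sum_univ_succ] using half_add_sum_div_two_mul_le hδ nu)
    (Fin.cases (div_nonneg hδ zero_le_two) fun i => by
      rw [Fin.cons_succ]
      positivity)
    (Fin.cases hp hq)
  exact ⟨E, hE, hPE, fun ω hω => ⟨hEpq ω hω 0, fun i => hEpq ω hω i.succ⟩⟩

end Experiments

end BilinearID

theorem mainTheorem4_general {nx nu : ℕ}
    (A : Matrix (Fin nx) (Fin nx) ℝ) (B₀ : Matrix (Fin nx) (Fin nu) ℝ)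
    (B : Fin nu → Matrix (Fin nx) (Fin nx) ℝ)
    (σw : ℝ) (hσw : 0 < σw) (δ : ℝ) (hδ : δ ∈ Set.Ioo (0 : ℝ) 1)
    (T : Fin (nu + 1) → ℕ) {Ω : Type*} [MeasurableSpace Ω] (P : Measure Ω) [IsProbabilityMeasure P]
    (x w : (i : Fin (nu + 1)) → Fin (T i) → Ω → EuclideanSpace ℝ (Fin nx))
    (hindep : ∀ i, iIndepFun (fun t ω => (x i t ω, w i t ω)) P)
    (hx : ∀ i t, AEMeasurable (x i t) P)
    (hxw : ∀ i t, IndepFun (x i t) (w i t) P)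
    (hw : ∀ i t, HasLaw (w i t)
      (multivariateGaussian 0 (σw ^ 2 • (1 : Matrix (Fin nx) (Fin nx) ℝ))) P)
    (xplus : (i : Fin (nu + 1)) → Fin (T i) → Ω → EuclideanSpace ℝ (Fin nx))
    (hxplus : ∀ i t ω, xplus i t ω =
      BilinearID.step A B₀ B (x i t ω) (BilinearID.input i) (w i t ω))
    (Ahat : Ω → Matrix (Fin nx) (Fin nx) ℝ) (B₀hat : Ω → Matrix (Fin nx) (Fin nu) ℝ)
    (Bhat : Fin nu → Ω → Matrix (Fin nx) (Fin nx) ℝ)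
    (hAhat : ∀ ω, BilinearID.IsOLS (fun t => (x 0 t ω).ofLp) (fun t => xplus 0 t ω) (Ahat ω))
    (hBhat : ∀ i ω, BilinearID.IsOLS (fun t => BilinearID.affineRegressor (x i.succ t ω))
      (fun t => xplus i.succ t ω) (BilinearID.appendCol (Bhat i ω) ((B₀hat ω).col i))) :
    ∃ E : Set Ω, MeasurableSet E ∧ ENNReal.ofReal (1 - δ) ≤ P E ∧ ∀ ω ∈ E,
      BilinearID.LeScaledInv ((Ahat ω - A)ᵀ * (Ahat ω - A))
        (σw ^ 2 * (2 * √(nx : ℝ) + √(2 * Real.log (2 / δ))) ^ 2)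
        (BilinearID.gram_posSemidef (fun t => (x 0 t ω).ofLp)) ∧
      ∀ i : Fin nu,
        BilinearID.LeScaledInv
          ((BilinearID.appendCol (Bhat i ω - B i) ((B₀hat ω - B₀).col i))ᵀ *
            BilinearID.appendCol (Bhat i ω - B i) ((B₀hat ω - B₀).col i))
          (σw ^ 2 * (√((nx : ℝ) + 1) + √(nx : ℝ) + √(2 * Real.log (2 * nu / δ))) ^ 2)
          (BilinearID.gram_posSemidef
            (fun t => BilinearID.affineRegressor (x i.succ t ω))) := by
  have hδ0 : 0 < δ := hδ.1
  have hδ_zero : δ / 2 ∈ Set.Ioo (0 : ℝ) 1 := ⟨by positivity, by linarith [hδ.2]⟩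
  have hδ_succ : ∀ _i : Fin nu, δ / (2 * nu) ∈ Set.Ioo (0 : ℝ) 1 := fun i => by
    have hnu : (1 : ℝ) ≤ nu := mod_cast i.pos
    exact ⟨by positivity, (div_lt_one (by positivity)).2 (by linarith [hδ.2])⟩
  refine BilinearID.exists_measurableSet_and_forall_mem hδ0.le ?_ fun i => ?_
  · simpa only [inv_div] using BilinearID.measure_not_leScaledInv_input_zero_le hσw hδ_zero
      (hindep 0) (hxw 0) (hx 0) (hw 0) (hxplus 0) hAhat
  · simpa only [inv_div] using BilinearID.measure_not_leScaledInv_input_succ_le hσw (hδ_succ i)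
      (hindep i.succ) (hxw i.succ) (hx i.succ) (hw i.succ) (hxplus i.succ) (hBhat i)

theorem mainTheorem4 {nx nu : ℕ}
    -- the unknown system, the noise level, the failure probability and the sample sizes
    (A : Matrix (Fin nx) (Fin nx) ℝ) (B₀ : Matrix (Fin nx) (Fin nu) ℝ)
    (B : Fin nu → Matrix (Fin nx) (Fin nx) ℝ)
    (σw : ℝ) (hσw : 0 < σw) (δ : ℝ) (hδ : δ ∈ Set.Ioo (0 : ℝ) 1)
    (T : Fin (nu + 1) → ℕ) (hT₀ : nx ≤ T 0) (hT : ∀ i : Fin nu, nx + 1 ≤ T i.succ)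
    {Ω : Type*} [MeasurableSpace Ω] (P : Measure Ω) [IsProbabilityMeasure P]
    -- sampled states and noise in each of the `nu + 1` experiments
    (x w : (i : Fin (nu + 1)) → Fin (T i) → Ω → EuclideanSpace ℝ (Fin nx))
    (hindep : ∀ i, iIndepFun (fun t ω => (x i t ω, w i t ω)) P)
    (hident : ∀ i s t, IdentDistrib (x i s) (x i t) P P)
    (hxw : ∀ i t, IndepFun (x i t) (w i t) P)
    (hw : ∀ i t, HasLaw (w i t)
      (multivariateGaussian 0 (σw ^ 2 • (1 : Matrix (Fin nx) (Fin nx) ℝ))) P)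
    -- the successor states produced by the bilinear system under the input of the experiment
    (xplus : (i : Fin (nu + 1)) → Fin (T i) → Ω → EuclideanSpace ℝ (Fin nx))
    (hxplus : ∀ i t ω, xplus i t ω =
      BilinearID.step A B₀ B (x i t ω) (BilinearID.input i) (w i t ω))
    -- the ordinary least squares estimates
    (Ahat : Ω → Matrix (Fin nx) (Fin nx) ℝ) (B₀hat : Ω → Matrix (Fin nx) (Fin nu) ℝ)
    (Bhat : Fin nu → Ω → Matrix (Fin nx) (Fin nx) ℝ)
    (hAhat : ∀ ω, BilinearID.IsOLS (fun t => (x 0 t ω).ofLp) (fun t => xplus 0 t ω) (Ahat ω))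
    (hBhat : ∀ i ω, BilinearID.IsOLS (fun t => BilinearID.affineRegressor (x i.succ t ω))
      (fun t => xplus i.succ t ω) (BilinearID.appendCol (Bhat i ω) ((B₀hat ω).col i))) :
    ∃ E : Set Ω, MeasurableSet E ∧ ENNReal.ofReal (1 - δ) ≤ P E ∧ ∀ ω ∈ E,
      BilinearID.LeScaledInv ((Ahat ω - A)ᵀ * (Ahat ω - A))
        (σw ^ 2 * (2 * √(nx : ℝ) + √(2 * Real.log (2 / δ))) ^ 2)
        (BilinearID.gram_posSemidef (fun t => (x 0 t ω).ofLp)) ∧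
      ∀ i : Fin nu,
        BilinearID.LeScaledInv
          ((BilinearID.appendCol (Bhat i ω - B i) ((B₀hat ω - B₀).col i))ᵀ *
            BilinearID.appendCol (Bhat i ω - B i) ((B₀hat ω - B₀).col i))
          (σw ^ 2 * (√((nx : ℝ) + 1) + √(nx : ℝ) + √(2 * Real.log (2 * nu / δ))) ^ 2)
          (BilinearID.gram_posSemidef
            (fun t => BilinearID.affineRegressor (x i.succ t ω))) :=
  mainTheorem4_general A B₀ B σw hσw δ hδ T P x w hindep
    (fun i t => (hident i t t).aemeasurable_fst) hxw hw xplus hxplus Ahat B₀hat Bhat hAhat hBhat
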